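/- **Setting.** Let $h\ge 1$, $n,m\ge 0$ be integers and consider the coordinates $t$, $x_1,\dots,x_n$ and $u^k_{s,I}$ ($1\le k\le m$, $0\le s<h$, $I\in\mathbb Z_{\ge0}^n$), where $u^k_{s,I}$ stands for $\partial^{s+|I|}u^k/\partial t^s\partial x^I$. Let $\mathcal F_{\mathcal E}$ be the algebra of smooth real functions on a fixed open domain of the space of these coordinates (with the product topology), each function depending on finitely many coordinates. Let $F=(F^1,\dots,F^m)$, $F^i\in\mathcal F_{\mathcal E}$, depend only on $t$, $x_j$, the pure space derivatives $u^k_{0,I}$ and the pure time derivatives $u^k_{s,0}$, $s<h$, and consider the system of generalized evolution form $$\frac{\partial^h u^i}{\partial t^h}=F^i,\qquad i=1,\dots,m .$$ On $\mathcal F_{\mathcal E}$ we have the total derivatives restricted to the system, $$\bar D_{x_i}=\frac{\partial}{\partial x_i}+\sum_{k,s,I}u^k_{s,I+1_i}\frac{\partial}{\partial u^k_{s,I}},\qquad \bar D_t=\frac{\partial}{\partial t}+\sum_{k,I,\,s<h-1}u^k_{s+1,I}\frac{\partial}{\partial u^k_{s,I}}+\sum_{k,I}\bar D_x^I(F^k)\frac{\partial}{\partial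 u^k_{h-1,I}} .$$ *Order and symbol.* For a vector-function $f$ with components in $\mathcal F_{\mathcal E}$, $\mathrm o(f)$ is the largest $|I|$ with some $\partial f/\partial u^k_{s,I}\ne0$, and $\mathrm o(f)=-1$ if there is none; if $\mathrm o(f)\ge 0$, $\mathrm t(f)$ is the largest $s$ with $\partial f/\partial u^k_{s,I}\neq 0$ for some $k$ and some $|I|=\mathrm o(f)$. The symbol $\mathbf S_f$ is the matrix with the entries $[\mathbf S_f]_{ij}=\sum_{|I|=\mathrm o(f)}\frac{\partial f_i}{\partial u^j_{\mathrm t(f),I}}\,q^I\in\mathcal F_{\mathcal E}[q_1,\dots,q_n]$. Put $N=\mathrm o(F)$, assume $N>0$, and let $A=\mathbf S_F$. *The constant $O$.* Let $L$ be the $m\times m$ matrix differential operator $$[L]_{ij}=\sum_I(-1)^{|I|}\bar D_x^I\circ\frac{\partial F^j}{\partial u^i_{0,I}}+\sum_{s=1}^{h-1}(-1)^s\bar D_t^s\circ\frac{\partial F^j}{\partial u^i_{s,0}},$$ so that $(-1)^h\bar D_t^h-L$ is the adjoint of the linearization of the system. *Conservation laws.* A conserved current is a tuple $(J_0,\dots,J_n)$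 of elements of $\mathcal F_{\mathcal E}$ with $\bar D_tJ_0+\sum_i\bar D_{x_i}J_i=0$. On the space of all jets (coordinates $t,x_j,u^k_{s,I}$, all $s\ge0$) over the domain, let $D_t,D_{x_i}$ be the usual total derivatives and $\mathcal I$ the ideal of smooth functions (of finitely many coordinates) generated by all $D_t^sD_x^I(u^k_{h,0}-F^k)$; modulo $\mathcal I$, every function equals a unique element of $\mathcal F_{\mathcal E}$. If $\tilde J_i$ are representatives of the $J_i$ modulo $\mathcal I$ and $$D_t\tilde J_0+\sum_iD_{x_i}\tilde J_i=\sum_{k,s,I}g^k_{s,I}\,D_t^sD_x^I(u^k_{h,0}-F^k)$$ (a finite sum), then $\chi=(\chi_1,\dots,\chi_m)$, where $\chi_k\in\mathcal F_{\mathcal E}$ is the class of $\sum_{s,I}(-1)^{s+|I|}D_t^sD_x^I(g^k_{s,I})$ modulo $\mathcal I$, is called the characteristic of the conservation law given by $(J_0,\dots,J_n)$. **Theorem.** The operators $[L]_{ij}$ can be uniquely written in the form $[L]_{ij}=\sum_{|I|\le N}f_I^{ij}\bar D_x^I+\sum_{1\le s<h}g_s^{ij}\bar D_t^s$ with coefficients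 in $\mathcal F_{\mathcal E}$, and $$O=\max_{i,j,I,s}\{-1,\ \mathrm o(f_I^{ij})-N,\ \mathrm o(g_s^{ij})-N\}$$ satisfies $O\le N$. If $\chi$ is the characteristic of a conservation law of the system and $\mathrm o(\chi)>O$, then $$\mathbf S_\chi A=(-1)^{N+h}A^{t}\,\mathbf S_\chi .$$ -/

import Mathlib

open scoped ContDiff

noncomputable section

namespace JetCons

/-! ### Smooth functions of finitely many of (possibly infinitely many) variables -/

/-- The algebra of smooth real functions on an open set `U` of `ℝ^ι` (product topology), each of
which depends on finitely many of the variables only. -/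
def SmoothFn {ι : Type} (U : TopologicalSpace.Opens (ι → ℝ)) : Subalgebra ℝ (U → ℝ) where
  carrier := {f | ∃ (S : Finset ι) (g : (S → ℝ) → ℝ),
    ContDiffOn ℝ ∞ g (S.restrict '' (U : Set (ι → ℝ))) ∧ ∀ θ : U, f θ = g (S.restrict θ.1)}
  mul_mem' := by
    classical
    rintro f₁ f₂ ⟨S, g, hg, hf⟩ ⟨T, k, hk, hf'⟩
    refine ⟨S ∪ T, fun y : ((S ∪ T : Finset ι) → ℝ) => g (Finset.restrict₂ (π := fun _ => ℝ) Finset.subset_union_left y) *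
      k (Finset.restrict₂ (π := fun _ => ℝ) Finset.subset_union_right y), ContDiffOn.mul ?_ ?_, ?_⟩
    · refine hg.comp (contDiff_pi.2 fun i => contDiff_apply ℝ ℝ _).contDiffOn ?_
      rintro _ ⟨θ, hθ, rfl⟩
      exact ⟨θ, hθ, rfl⟩
    · refine hk.comp (contDiff_pi.2 fun i => contDiff_apply ℝ ℝ _).contDiffOn ?_
      rintro _ ⟨θ, hθ, rfl⟩
      exact ⟨θ, hθ, rfl⟩
    · intro θ
      simp only [Pi.mul_apply, hf, hf']
      rfl
  add_mem' := by
    classical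
    rintro f₁ f₂ ⟨S, g, hg, hf⟩ ⟨T, k, hk, hf'⟩
    refine ⟨S ∪ T, fun y : ((S ∪ T : Finset ι) → ℝ) => g (Finset.restrict₂ (π := fun _ => ℝ) Finset.subset_union_left y) +
      k (Finset.restrict₂ (π := fun _ => ℝ) Finset.subset_union_right y), ContDiffOn.add ?_ ?_, ?_⟩
    · refine hg.comp (contDiff_pi.2 fun i => contDiff_apply ℝ ℝ _).contDiffOn ?_
      rintro _ ⟨θ, hθ, rfl⟩
      exact ⟨θ, hθ, rfl⟩
    · refine hk.comp (contDiff_pi.2 fun i => contDiff_apply ℝ ℝ _).contDiffOn ?_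
      rintro _ ⟨θ, hθ, rfl⟩
      exact ⟨θ, hθ, rfl⟩
    · intro θ
      simp only [Pi.add_apply, hf, hf']
      rfl
  algebraMap_mem' r := ⟨∅, fun _ => r, contDiffOn_const, fun _ => rfl⟩

/-- A coordinate as a smooth function on `U`. -/
def coordFn {ι : Type} {U : TopologicalSpace.Opens (ι → ℝ)} (c : ι) : SmoothFn U :=
  ⟨fun θ => θ.1 c, {c}, fun y => y ⟨c, Finset.mem_singleton_self c⟩,
    (contDiff_apply ℝ ℝ _).contDiffOn, fun _ => rfl⟩

open Classical in
/-- The partial derivative with respect to the coordinate `c`, on plain functions on `U`. -/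
def pdFun {ι : Type} {U : TopologicalSpace.Opens (ι → ℝ)} (c : ι) (f : U → ℝ) : U → ℝ :=
  fun θ => deriv (fun r : ℝ =>
    if hr : Function.update θ.1 c r ∈ U then f ⟨Function.update θ.1 c r, hr⟩ else 0) (θ.1 c)

theorem isOpen_restrict_image {ι : Type} (U : TopologicalSpace.Opens (ι → ℝ)) (S : Finset ι) :
    IsOpen (S.restrict '' (U : Set (ι → ℝ))) := by
  classical
  rw [isOpen_iff_mem_nhds]
  rintro _ ⟨θ, hθ, rfl⟩
  let e : (S → ℝ) → (ι → ℝ) := fun y i => if h : i ∈ S then y ⟨i, h⟩ else θ i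
  have he : Continuous e := by
    refine continuous_pi fun i => ?_
    by_cases h : i ∈ S
    · simp only [e, h, dite_true]; exact continuous_apply _
    · simp only [e, h, dite_false]; exact continuous_const
  have he0 : e (S.restrict θ) = θ := by
    funext i; simp [e]
  have hmem : e ⁻¹' (U : Set (ι → ℝ)) ∈ nhds (S.restrict θ) := by
    apply he.continuousAt.preimage_mem_nhds
    rw [he0]; exact U.isOpen.mem_nhds hθ
  refine Filter.mem_of_superset hmem fun y hy => ⟨e y, hy, ?_⟩
  funext i
  simp [e]

theorem pdFun_mem {ι : Type} {U : TopologicalSpace.Opens (ι → ℝ)} (c : ι) {f : U → ℝ}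
    (hf : f ∈ SmoothFn U) : pdFun c f ∈ SmoothFn U := by
  classical
  obtain ⟨S, g, hg, hfg⟩ := hf
  have hopen := isOpen_restrict_image U S
  have hev : ∀ θ : U, (fun r : ℝ => if hr : Function.update θ.1 c r ∈ U
      then f ⟨Function.update θ.1 c r, hr⟩ else 0) =ᶠ[nhds (θ.1 c)]
      fun r => g (S.restrict (Function.update θ.1 c r)) := by
    intro θ
    have hc : Continuous fun r : ℝ => Function.update θ.1 c r :=
      continuous_const.update c continuous_id
    have : ∀ᶠ r in nhds (θ.1 c), Function.update θ.1 c r ∈ (U : Set (ι → ℝ)) := by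
      apply hc.continuousAt.eventually_mem
      rw [Function.update_eq_self]; exact U.isOpen.mem_nhds θ.2
    filter_upwards [this] with r hr
    have hr' : Function.update θ.1 c r ∈ U := hr
    simp only [hr', dite_true]
    exact hfg _
  by_cases hcS : c ∈ S
  · refine ⟨S, fun y => fderiv ℝ g y (Pi.single ⟨c, hcS⟩ 1), ?_, ?_⟩
    · exact (hg.fderiv_of_isOpen hopen (by simp)).clm_apply contDiffOn_const
    · intro θ
      simp only [pdFun, (hev θ).deriv_eq]
      have hup : ∀ r, S.restrict (Function.update θ.1 c r)
          = Function.update (S.restrict θ.1) ⟨c, hcS⟩ r := by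
        intro r
        funext i
        by_cases hi : i = ⟨c, hcS⟩
        · subst hi; simp
        · have : (i : ι) ≠ c := fun h => hi (Subtype.ext h)
          simp [hi, this]
      simp only [hup]
      have hd : DifferentiableAt ℝ g (S.restrict θ.1) :=
        (hg.contDiffAt (hopen.mem_nhds ⟨θ.1, θ.2, rfl⟩)).differentiableAt (by simp)
      have hu := hasDerivAt_update (S.restrict θ.1) ⟨c, hcS⟩ (θ.1 c)
      have hd' : HasFDerivAt g (fderiv ℝ g (S.restrict θ.1))
          (Function.update (S.restrict θ.1) ⟨c, hcS⟩ (θ.1 c)) := by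
        have : Function.update (S.restrict θ.1) ⟨c, hcS⟩ (θ.1 c) = S.restrict θ.1 :=
          Function.update_eq_self (⟨c, hcS⟩ : S) (S.restrict θ.1)
        rw [this]; exact hd.hasFDerivAt
      exact (hd'.comp_hasDerivAt (θ.1 c) hu).deriv
  · refine ⟨∅, fun _ => 0, contDiffOn_const, ?_⟩
    intro θ
    simp only [pdFun, (hev θ).deriv_eq]
    have hup : ∀ r, S.restrict (Function.update θ.1 c r) = S.restrict θ.1 := by
      intro r
      funext i
      have : (i : ι) ≠ c := fun h => hcS (h ▸ i.2)
      simp [this]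
    simp only [hup, deriv_const]

/-- The partial derivative `∂f/∂c` of a smooth function of finitely many variables. -/
def pd {ι : Type} {U : TopologicalSpace.Opens (ι → ℝ)} (c : ι) (f : SmoothFn U) : SmoothFn U :=
  ⟨pdFun c f.1, pdFun_mem c f.2⟩

/-- The first order operator `∑_c w_c ∂/∂c`; on each function the sum is finite. -/
def vf {ι : Type} {U : TopologicalSpace.Opens (ι → ℝ)} (w : ι → SmoothFn U) (f : SmoothFn U) :
    SmoothFn U :=
  ∑ᶠ c, w c * pd c f

/-! ### Jet coordinates and total derivatives -/

/-- The coordinates `t`, `x_j` and `u^k_{s,I}`, where `s` (in `σ`) counts the `t`-derivatives and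
the multi-index `I` the space derivatives. All jets: `σ = ℕ`. Solutions of a system with
left-hand side `∂^h u / ∂t^h`: `σ = Fin h`. -/
inductive Coord (n m : ℕ) (σ : Type) : Type
  | t : Coord n m σ
  | x (j : Fin n) : Coord n m σ
  | u (k : Fin m) (s : σ) (I : Fin n →₀ ℕ) : Coord n m σ

variable {n m h : ℕ}

/-- `D_{x_j} = ∂/∂x_j + ∑ u^k_{s,I+1_j} ∂/∂u^k_{s,I}`. -/
def Dx {σ : Type} {U : TopologicalSpace.Opens (Coord n m σ → ℝ)} (j : Fin n) :
    SmoothFn U → SmoothFn U :=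
  vf fun
    | Coord.t => 0
    | Coord.x i => if i = j then 1 else 0
    | Coord.u k s I => coordFn (Coord.u k s (I + Finsupp.single j 1))

/-- `D_x^I = D_{x_1}^{i_1} ⋯ D_{x_n}^{i_n}`. -/
def DxI {σ : Type} {U : TopologicalSpace.Opens (Coord n m σ → ℝ)} (I : Fin n →₀ ℕ)
    (f : SmoothFn U) : SmoothFn U :=
  (List.finRange n).foldr (fun j g => (Dx j)^[I j] g) f

/-- The total `t`-derivative `D_t` on the space of all jets. -/
def Dt {U : TopologicalSpace.Opens (Coord n m ℕ → ℝ)} : SmoothFn U → SmoothFn U :=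
  vf fun
    | Coord.t => 1
    | Coord.x _ => 0
    | Coord.u k s I => coordFn (Coord.u k (s + 1) I)

/-- The restricted total `t`-derivative `D̄_t` for the system `u^k_{h,0} = F^k`, in the coordinates
`t, x_j, u^k_{s,I}`, `s < h`. -/
def DtBar {U : TopologicalSpace.Opens (Coord n m (Fin h) → ℝ)} (F : Fin m → SmoothFn U) :
    SmoothFn U → SmoothFn U :=
  vf fun
    | Coord.t => 1
    | Coord.x _ => 0
    | Coord.u k s I =>
        if hs : s.1 + 1 < h then coordFn (Coord.u k ⟨s.1 + 1, hs⟩ I) else DxI I (F k)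

/-- `∂f/∂u^k_{s,I}` for a function of the coordinates with `s < h` (zero for `s ≥ h`). -/
def pdu {U : TopologicalSpace.Opens (Coord n m (Fin h) → ℝ)} (k : Fin m) (s : ℕ)
    (I : Fin n →₀ ℕ) (f : SmoothFn U) : SmoothFn U :=
  if hs : s < h then pd (Coord.u k ⟨s, hs⟩ I) f else 0

/-! ### Systems of generalized evolution form -/

/-- The right-hand sides depend only on `t`, `x_j`, the pure space derivatives `u^k_{0,I}` and the
pure time derivatives `u^k_{s,0}`, `s < h`. -/
def IsGenEvolution {U : TopologicalSpace.Opens (Coord n m (Fin h) → ℝ)}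
    (F : Fin m → SmoothFn U) : Prop :=
  ∀ i k s I, s ≠ 0 → I ≠ 0 → pdu k s I (F i) = 0

/-! ### Order and symbol -/

/-- The order `o(f)` of a vector-function with respect to the space variables
(`-1` if it depends on `t`, `x_j` only). -/
def order {p : ℕ} {U : TopologicalSpace.Opens (Coord n m (Fin h) → ℝ)} (f : Fin p → SmoothFn U) :
    ℤ :=
  sSup ({-1} ∪ {r : ℤ | ∃ i k s I, pdu k s I (f i) ≠ 0 ∧ r = (I.degree : ℤ)})

/-- The maximal `s < h` with `∂f/∂u^k_{s,I} ≠ 0` for some `k` and some `|I| = o(f)`. -/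
def tOrder {p : ℕ} {U : TopologicalSpace.Opens (Coord n m (Fin h) → ℝ)} (f : Fin p → SmoothFn U) :
    ℕ :=
  sSup {s : ℕ | ∃ i k I, pdu k s I (f i) ≠ 0 ∧ (I.degree : ℤ) = order f}

/-- The `p × m` matrix with entries `∑_{|I| = a} (∂f_i/∂u^j_{b,I}) q^I`. -/
def symbolAt {p : ℕ} {U : TopologicalSpace.Opens (Coord n m (Fin h) → ℝ)} (a b : ℕ)
    (f : Fin p → SmoothFn U) : Matrix (Fin p) (Fin m) (MvPolynomial (Fin n) (SmoothFn U)) :=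
  Matrix.of fun i j =>
    ∑ I ∈ Finset.finsuppAntidiag Finset.univ a, MvPolynomial.monomial I (pdu j b I (f i))

/-- The symbol of a vector-function (meaningful if its order is not `-1`). -/
def symbol {p : ℕ} {U : TopologicalSpace.Opens (Coord n m (Fin h) → ℝ)}
    (f : Fin p → SmoothFn U) : Matrix (Fin p) (Fin m) (MvPolynomial (Fin n) (SmoothFn U)) :=
  symbolAt (order f).toNat (tOrder f) f

/-! ### The adjoint linearized operator and the constant `O` -/

/-- The entry `L_{ij}` of the operator `L`, where `(-1)^h D̄_t^h - L` is the adjoint of the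
linearization of the system. The variable `u^i_{0,0}` is counted once, in the first sum. -/
def adjL {U : TopologicalSpace.Opens (Coord n m (Fin h) → ℝ)} (F : Fin m → SmoothFn U)
    (i j : Fin m) (ψ : SmoothFn U) : SmoothFn U :=
  (∑ᶠ I : Fin n →₀ ℕ, (-1) ^ I.degree * DxI I (pdu i 0 I (F j) * ψ)) +
    ∑ s ∈ Finset.Ico 1 h, (-1) ^ s * (DtBar F)^[s] (pdu i s 0 (F j) * ψ)

/-- Coefficients of an `m × m` matrix of operators `∑_I f_I^{ij} D̄_x^I + ∑_s g_s^{ij} D̄_t^s`. -/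
structure OpCoeffs (U : TopologicalSpace.Opens (Coord n m (Fin h) → ℝ)) where
  f : Fin m → Fin m → (Fin n →₀ ℕ) → SmoothFn U
  g : Fin m → Fin m → ℕ → SmoothFn U

/-- `L_{ij} = ∑_{|I| ≤ N} f_I^{ij} D̄_x^I + ∑_{1 ≤ s < h} g_s^{ij} D̄_t^s` as operators; the
coefficients outside of these ranges are zero. -/
def IsNormalForm {U : TopologicalSpace.Opens (Coord n m (Fin h) → ℝ)} (F : Fin m → SmoothFn U)
    (N : ℕ) (C : OpCoeffs U) : Prop :=
  (∀ i j I, N < I.degree → C.f i j I = 0) ∧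
  (∀ i j s, s ∉ Finset.Ico 1 h → C.g i j s = 0) ∧
  ∀ i j ψ, adjL F i j ψ =
    (∑ᶠ I : Fin n →₀ ℕ, C.f i j I * DxI I ψ) +
      ∑ s ∈ Finset.Ico 1 h, C.g i j s * (DtBar F)^[s] ψ

/-- `O = max {-1, o(f_I^{ij}) - N, o(g_s^{ij}) - N}`. -/
def constO {U : TopologicalSpace.Opens (Coord n m (Fin h) → ℝ)} (N : ℕ) (C : OpCoeffs U) : ℤ :=
  sSup ({-1} ∪ {r : ℤ | ∃ i j I, r = order ![C.f i j I] - N} ∪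
    {r : ℤ | ∃ i j s, r = order ![C.g i j s] - N})

/-! ### Conserved currents and characteristics -/

/-- `(J_0, J_1, …, J_n)` is a conserved current: `D̄_t J_0 + ∑ D̄_{x_i} J_i = 0`. -/
def IsConservedCurrent {U : TopologicalSpace.Opens (Coord n m (Fin h) → ℝ)}
    (F : Fin m → SmoothFn U) (J₀ : SmoothFn U) (J : Fin n → SmoothFn U) : Prop :=
  DtBar F J₀ + ∑ i, Dx i (J i) = 0

/-- The coordinates with `s < h` among all jet coordinates. -/
def Coord.incl : Coord n m (Fin h) → Coord n m ℕ
  | Coord.t => Coord.t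
  | Coord.x j => Coord.x j
  | Coord.u k s I => Coord.u k s.1 I

/-- The set of all jets whose coordinates with `s < h` form a point of `U`. -/
def fullJets (U : TopologicalSpace.Opens (Coord n m (Fin h) → ℝ)) :
    TopologicalSpace.Opens (Coord n m ℕ → ℝ) :=
  ⟨{θ | θ ∘ Coord.incl ∈ U},
    U.isOpen.preimage (continuous_pi fun c => continuous_apply (Coord.incl c))⟩

/-- A function of the coordinates with `s < h`, regarded as a function on the space of all jets. -/
def lift {U : TopologicalSpace.Opens (Coord n m (Fin h) → ℝ)} (f : SmoothFn U) :
    SmoothFn (fullJets U) :=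
  ⟨fun θ => f.1 ⟨θ.1 ∘ Coord.incl, θ.2⟩, by
    classical
    obtain ⟨S, g, hg, hf⟩ := f.2
    refine ⟨S.image Coord.incl,
      fun y => g fun i => y ⟨Coord.incl i.1, Finset.mem_image_of_mem _ i.2⟩, ?_, ?_⟩
    · refine hg.comp (contDiff_pi.2 fun i => contDiff_apply ℝ ℝ _).contDiffOn ?_
      rintro _ ⟨θ, hθ, rfl⟩
      exact ⟨θ ∘ Coord.incl, hθ, rfl⟩
    · intro θ
      exact hf _⟩

/-- The left-hand side `u^k_{h,0} - F^k` of the system, on the space of all jets. -/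
def eqn {U : TopologicalSpace.Opens (Coord n m (Fin h) → ℝ)} (F : Fin m → SmoothFn U)
    (k : Fin m) : SmoothFn (fullJets U) :=
  coordFn (Coord.u k h 0) - lift (F k)

/-- The ideal generated by the equations and all their differential consequences. A function on
the space of all jets equals, modulo this ideal, a unique function of the coordinates with
`s < h`. -/
def eqnIdeal {U : TopologicalSpace.Opens (Coord n m (Fin h) → ℝ)} (F : Fin m → SmoothFn U) :
    Ideal (SmoothFn (fullJets U)) :=
  Ideal.span {f | ∃ k s I, f = Dt^[s] (DxI I (eqn F k))}

/-- `χ` is the characteristic of the conservation law given by the conserved current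
`(J_0, J_1, …, J_n)`: for representatives `K` of the components of the current and a representation
`D_t K_0 + ∑ D_{x_i} K_i = ∑ g^k_{s,I} D_t^s D_x^I (u^k_{h,0} - F^k)` (finite sums) on the space of
all jets, `χ_k` is the class of `∑ (-1)^{s+|I|} D_t^s D_x^I (g^k_{s,I})`. -/
def IsCharacteristic {U : TopologicalSpace.Opens (Coord n m (Fin h) → ℝ)}
    (F : Fin m → SmoothFn U) (J₀ : SmoothFn U) (J : Fin n → SmoothFn U)
    (χ : Fin m → SmoothFn U) : Prop :=
  ∃ (K₀ : SmoothFn (fullJets U)) (K : Fin n → SmoothFn (fullJets U))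
    (g : Fin m → (ℕ × (Fin n →₀ ℕ)) →₀ SmoothFn (fullJets U)),
    K₀ - lift J₀ ∈ eqnIdeal F ∧
    (∀ i, K i - lift (J i) ∈ eqnIdeal F) ∧
    Dt K₀ + ∑ i, Dx i (K i) =
      ∑ k, (g k).sum (fun p c => c * Dt^[p.1] (DxI p.2 (eqn F k))) ∧
    ∀ k, (g k).sum (fun p c => (-1) ^ (p.1 + p.2.degree) * Dt^[p.1] (DxI p.2 c)) - lift (χ k)
      ∈ eqnIdeal F

end JetCons

end

/-!
The Euler operator annihilates total divergences, and applied to `∑ g Dᴵ(eqn)` and restricted to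
solutions it only sees the characteristic `χ`. Hence `χ` satisfies the adjoint linearized system
`(-1)ʰ D̄ₜʰ χ = L χ`, and the symbol identity is the top-order part of this equation. Over `h`
time steps each `u_{s,I}` passes once through `D̄ₓᴵ F`, so `D̄ₜʰ` raises the space order by `N`
and multiplies the symbol by `A` from the right; `L` raises the order by `N` as well and its
leading part is `(-1)ᴺ Aᵗ`. The coefficients of `L` have order at most `N + O < N + o(χ)`, so they
do not depend on the jets of top order.

The normal form of `L` comes from the Leibniz rule. It is unique because its coefficients are
recovered by applying the operator to monomials in `x` and to powers of `t`.
-/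

noncomputable section

namespace JetCons

/-! ### Calculus of smooth functions -/

section PartialDerivatives

variable {ι : Type} {U : TopologicalSpace.Opens (ι → ℝ)}

@[ext]
theorem SmoothFn.ext {f g : SmoothFn U} (hfg : ∀ θ, f.1 θ = g.1 θ) : f = g :=
  Subtype.ext (funext hfg)

/-- `g` expresses `f` as a smooth function of the coordinates in `S`. -/
structure Represents (S : Finset ι) (g : (S → ℝ) → ℝ) (f : SmoothFn U) : Prop where
  contDiffOn : ContDiffOn ℝ ∞ g (S.restrict '' (U : Set (ι → ℝ)))
  apply_eq : ∀ θ : U, f.1 θ = g (S.restrict θ.1)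

theorem exists_represents (f : SmoothFn U) : ∃ S g, Represents S g f :=
  let ⟨S, g, hg, hf⟩ := f.2
  ⟨S, g, hg, hf⟩

theorem Represents.contDiffAt {f : SmoothFn U} {S : Finset ι} {g : (S → ℝ) → ℝ}
    (hg : Represents S g f) (θ : U) : ContDiffAt ℝ ∞ g (S.restrict θ.1) :=
  hg.contDiffOn.contDiffAt ((isOpen_restrict_image U S).mem_nhds ⟨θ.1, θ.2, rfl⟩)

theorem Represents.hasFDerivAt {f : SmoothFn U} {S : Finset ι} {g : (S → ℝ) → ℝ}
    (hg : Represents S g f) (θ : U) :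
    HasFDerivAt g (fderiv ℝ g (S.restrict θ.1)) (S.restrict θ.1) :=
  ((hg.contDiffAt θ).differentiableAt (by simp)).hasFDerivAt

open scoped Classical in
/-- The restriction of `f` to the line through `θ` in the direction of the coordinate `c`,
extended by zero outside of `U`; this is the function differentiated in `pdFun`. -/
def slice (f : U → ℝ) (θ : U) (c : ι) (r : ℝ) : ℝ :=
  if hr : Function.update θ.1 c r ∈ U then f ⟨Function.update θ.1 c r, hr⟩ else 0

theorem slice_self (f : U → ℝ) (θ : U) (c : ι) : slice f θ c (θ.1 c) = f θ := by
  simp [slice]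

theorem slice_add (f g : U → ℝ) (θ : U) (c : ι) :
    slice (f + g) θ c = slice f θ c + slice g θ c := by
  ext r
  by_cases hr : Function.update θ.1 c r ∈ U <;> simp [slice, hr]

theorem slice_mul (f g : U → ℝ) (θ : U) (c : ι) :
    slice (f * g) θ c = slice f θ c * slice g θ c := by
  ext r
  by_cases hr : Function.update θ.1 c r ∈ U <;> simp [slice, hr]

open scoped Classical in
theorem eventually_update_mem (θ : U) (c : ι) :
    ∀ᶠ r in nhds (θ.1 c), Function.update θ.1 c r ∈ U := by
  have hcont : Continuous fun r : ℝ => Function.update θ.1 c r :=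
    continuous_const.update c continuous_id
  exact hcont.continuousAt.eventually_mem <| U.isOpen.mem_nhds <| by simp

open scoped Classical in
/-- The unit vector in the direction of the coordinate `c`, in the coordinates from `S`
(zero if `c ∉ S`). -/
def unitVec (S : Finset ι) (c : ι) : S → ℝ := S.restrict (π := fun _ => ℝ) (Pi.single c 1)

open scoped Classical in
theorem unitVec_apply (S : Finset ι) (c : ι) (i : S) :
    unitVec S c i = if i.1 = c then 1 else 0 := by
  simp [unitVec, Pi.single_apply]

theorem unitVec_eq_zero {S : Finset ι} {c : ι} (hc : c ∉ S) : unitVec S c = 0 :=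
  funext fun i => by rw [unitVec_apply, if_neg (ne_of_mem_of_not_mem i.2 hc), Pi.zero_apply]

open scoped Classical in
theorem hasDerivAt_restrict_update (S : Finset ι) (θ : ι → ℝ) (c : ι) :
    HasDerivAt (fun r : ℝ => S.restrict (Function.update θ c r))
      (unitVec S c) (θ c) := by
  refine hasDerivAt_pi.2 fun i => ?_
  by_cases hic : i.1 = c
  · simpa [hic, unitVec_apply] using hasDerivAt_id' (θ c)
  · simpa [hic, unitVec_apply] using hasDerivAt_const (θ c) (θ i)

theorem Represents.hasDerivAt_slice {f : SmoothFn U} {S : Finset ι} {g : (S → ℝ) → ℝ}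
    (hg : Represents S g f) (θ : U) (c : ι) :
    HasDerivAt (slice f.1 θ c) (fderiv ℝ g (S.restrict θ.1) (unitVec S c))
      (θ.1 c) := by
  refine ((hg.hasFDerivAt θ).comp_hasDerivAt_of_eq (θ.1 c)
    (hasDerivAt_restrict_update S θ.1 c) (by simp)).congr_of_eventuallyEq ?_
  filter_upwards [eventually_update_mem θ c] with r hr
  simp only [slice, hr, dite_true, hg.apply_eq, Function.comp_apply]

theorem hasDerivAt_slice (f : SmoothFn U) (θ : U) (c : ι) :
    HasDerivAt (slice f.1 θ c) ((pd c f).1 θ) (θ.1 c) :=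
  let ⟨_, _, hg⟩ := exists_represents f
  (hg.hasDerivAt_slice θ c).differentiableAt.hasDerivAt

theorem pd_apply_eq_of_hasDerivAt {f : SmoothFn U} {θ : U} {c : ι} {d : ℝ}
    (hd : HasDerivAt (slice f.1 θ c) d (θ.1 c)) : (pd c f).1 θ = d :=
  (hasDerivAt_slice f θ c).unique hd

theorem Represents.pd {f : SmoothFn U} {S : Finset ι} {g : (S → ℝ) → ℝ}
    (hg : Represents S g f) (c : ι) :
    Represents S (fun y => fderiv ℝ g y (unitVec S c)) (pd c f) where
  contDiffOn := (hg.contDiffOn.fderiv_of_isOpen (isOpen_restrict_image U S) (by simp)).clm_apply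
    contDiffOn_const
  apply_eq θ := pd_apply_eq_of_hasDerivAt (hg.hasDerivAt_slice θ c)

theorem Represents.pd_eq_zero {f : SmoothFn U} {S : Finset ι} {g : (S → ℝ) → ℝ}
    (hg : Represents S g f) {c : ι} (hc : c ∉ S) : JetCons.pd c f = 0 := by
  ext θ
  rw [(hg.pd c).apply_eq, unitVec_eq_zero hc, map_zero]
  rfl

theorem pd_add (c : ι) (f g : SmoothFn U) : pd c (f + g) = pd c f + pd c g := by
  ext θ
  refine pd_apply_eq_of_hasDerivAt ?_
  exact slice_add f.1 g.1 θ c ▸ (hasDerivAt_slice f θ c).add (hasDerivAt_slice g θ c)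

theorem pd_mul (c : ι) (f g : SmoothFn U) : pd c (f * g) = f * pd c g + g * pd c f := by
  ext θ
  have hmul := (hasDerivAt_slice f θ c).mul (hasDerivAt_slice g θ c)
  rw [← slice_mul, slice_self, slice_self] at hmul
  rw [pd_apply_eq_of_hasDerivAt (f := f * g) hmul, add_comm, mul_comm _ (g.1 θ)]
  rfl

theorem pd_algebraMap (c : ι) (a : ℝ) : pd c (algebraMap ℝ (SmoothFn U) a) = 0 :=
  Represents.pd_eq_zero (S := ∅) (g := fun _ => a) ⟨contDiffOn_const, fun _ => rfl⟩
    (Finset.notMem_empty c)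

/-- The partial derivative `pd c` as a derivation of the algebra of smooth functions. -/
def pdDerivation (c : ι) : Derivation ℝ (SmoothFn U) (SmoothFn U) where
  toFun := pd c
  map_add' := pd_add c
  map_smul' a f := by simp [Algebra.smul_def, pd_mul, pd_algebraMap]
  map_one_eq_zero' := by simpa using pd_algebraMap (U := U) c 1
  leibniz' f g := by simpa [smul_eq_mul] using pd_mul c f g

theorem pd_zero (c : ι) : pd c (0 : SmoothFn U) = 0 := (pdDerivation c).map_zero

theorem pd_one (c : ι) : pd c (1 : SmoothFn U) = 0 := (pdDerivation c).map_one_eq_zero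

theorem pd_sub (c : ι) (f g : SmoothFn U) : pd c (f - g) = pd c f - pd c g :=
  (pdDerivation c).map_sub f g

theorem pd_sum (c : ι) {α : Type*} (s : Finset α) (f : α → SmoothFn U) :
    pd c (∑ a ∈ s, f a) = ∑ a ∈ s, pd c (f a) := map_sum (pdDerivation c) f s

open scoped Classical in
theorem pd_coordFn (c c' : ι) :
    pd c (coordFn c' : SmoothFn U) = if c = c' then 1 else 0 := by
  have hrep : Represents {c'} (fun y => y ⟨c', Finset.mem_singleton_self c'⟩)
      (coordFn c' : SmoothFn U) := ⟨(contDiff_apply ℝ ℝ _).contDiffOn, fun _ => rfl⟩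
  have hproj := hasFDerivAt_apply (𝕜 := ℝ) (F' := fun _ : ({c'} : Finset ι) => ℝ)
    ⟨c', Finset.mem_singleton_self c'⟩
  ext θ
  rw [(hrep.pd c).apply_eq, (hproj _).fderiv, ContinuousLinearMap.proj_apply, unitVec_apply]
  split_ifs with hc hc' hc'
  exacts [rfl, absurd hc.symm hc', absurd hc'.symm hc, rfl]

theorem Represents.pd_pd_apply {f : SmoothFn U} {S : Finset ι} {g : (S → ℝ) → ℝ}
    (hg : Represents S g f) (c c' : ι) (θ : U) :
    (JetCons.pd c (JetCons.pd c' f)).1 θ = fderiv ℝ (fderiv ℝ g) (S.restrict θ.1)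
      (unitVec S c) (unitVec S c') := by
  have hdiff : DifferentiableAt ℝ (fderiv ℝ g) (S.restrict θ.1) :=
    ((hg.contDiffAt θ).fderiv_right (m := ∞) (by simp)).differentiableAt (by simp)
  rw [((hg.pd c').pd c).apply_eq,
    (hdiff.hasFDerivAt.clm_apply (hasFDerivAt_const _ _)).fderiv]
  simp

theorem pd_comm (c c' : ι) (f : SmoothFn U) : pd c (pd c' f) = pd c' (pd c f) := by
  obtain ⟨S, g, hg⟩ := exists_represents f
  ext θ
  have hsymm : IsSymmSndFDerivAt ℝ g (S.restrict θ.1) :=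
    (hg.contDiffAt θ).isSymmSndFDerivAt
      (by simpa using (WithTop.coe_le_coe.2 le_top : ((2 : ℕ∞) : WithTop ℕ∞) ≤ ∞))
  rw [hg.pd_pd_apply, hg.pd_pd_apply, hsymm.eq]

theorem finite_pd_ne_zero (f : SmoothFn U) : {c | pd c f ≠ 0}.Finite := by
  obtain ⟨S, g, hg⟩ := exists_represents f
  exact S.finite_toSet.subset fun c hc => by_contra fun hcS => hc (hg.pd_eq_zero hcS)

/-- The finitely many coordinates with respect to which `f` has a nonzero partial derivative. -/
def supp (f : SmoothFn U) : Finset ι := (finite_pd_ne_zero f).toFinset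

theorem mem_supp {f : SmoothFn U} {c : ι} : c ∈ supp f ↔ pd c f ≠ 0 := by simp [supp]

theorem pd_eq_zero_of_notMem_supp {f : SmoothFn U} {c : ι} (hc : c ∉ supp f) : pd c f = 0 := by
  simpa [mem_supp] using hc

theorem Represents.supp_subset {f : SmoothFn U} {S : Finset ι} {g : (S → ℝ) → ℝ}
    (hg : Represents S g f) : supp f ⊆ S :=
  fun _ hc => by_contra fun hcS => mem_supp.1 hc (hg.pd_eq_zero hcS)

theorem supp_pd_subset (c : ι) (f : SmoothFn U) : supp (pd c f) ⊆ supp f := fun c' hc' =>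
  mem_supp.2 fun hzero => mem_supp.1 hc' (by rw [pd_comm, hzero, pd_zero])

end PartialDerivatives

section VectorFields

variable {ι : Type} {U : TopologicalSpace.Opens (ι → ℝ)}

theorem vf_eq_sum (w : ι → SmoothFn U) (f : SmoothFn U) {T : Finset ι} (hT : supp f ⊆ T) :
    vf w f = ∑ c ∈ T, w c * pd c f := by
  refine finsum_eq_sum_of_support_subset _ fun c hc => hT (mem_supp.2 fun hzero => hc ?_)
  simp [hzero]

theorem vf_add (w : ι → SmoothFn U) (f g : SmoothFn U) : vf w (f + g) = vf w f + vf w g := by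
  classical
  let T := supp (f + g) ∪ supp f ∪ supp g
  rw [vf_eq_sum w (f + g) (T := T) (by grind), vf_eq_sum w f (T := T) (by grind),
    vf_eq_sum w g (T := T) (by grind), ← Finset.sum_add_distrib]
  exact Finset.sum_congr rfl fun c _ => by rw [pd_add, mul_add]

theorem vf_mul (w : ι → SmoothFn U) (f g : SmoothFn U) :
    vf w (f * g) = f * vf w g + g * vf w f := by
  classical
  let T := supp (f * g) ∪ supp f ∪ supp g
  rw [vf_eq_sum w (f * g) (T := T) (by grind), vf_eq_sum w f (T := T) (by grind),
    vf_eq_sum w g (T := T) (by grind), Finset.mul_sum, Finset.mul_sum, ← Finset.sum_add_distrib]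
  exact Finset.sum_congr rfl fun c _ => by rw [pd_mul]; ring

theorem vf_algebraMap (w : ι → SmoothFn U) (a : ℝ) : vf w (algebraMap ℝ (SmoothFn U) a) = 0 := by
  simp only [vf, pd_algebraMap, mul_zero, finsum_zero]

/-- The vector field `vf w` as a derivation of the algebra of smooth functions. -/
def vfDerivation (w : ι → SmoothFn U) : Derivation ℝ (SmoothFn U) (SmoothFn U) where
  toFun := vf w
  map_add' := vf_add w
  map_smul' a f := by simp [Algebra.smul_def, vf_mul, vf_algebraMap]
  map_one_eq_zero' := by simpa using vf_algebraMap w 1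
  leibniz' f g := by simpa [smul_eq_mul] using vf_mul w f g

theorem vf_zero (w : ι → SmoothFn U) : vf w 0 = 0 := (vfDerivation w).map_zero

theorem vf_one (w : ι → SmoothFn U) : vf w 1 = 0 := (vfDerivation w).map_one_eq_zero

theorem vf_sum (w : ι → SmoothFn U) {α : Type*} (s : Finset α) (f : α → SmoothFn U) :
    vf w (∑ a ∈ s, f a) = ∑ a ∈ s, vf w (f a) := map_sum (vfDerivation w) f s

theorem vf_zero_left (f : SmoothFn U) : vf (fun _ => 0) f = 0 := by
  simp only [vf, zero_mul, finsum_zero]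

open scoped Classical in
theorem vf_indicator (c : ι) (f : SmoothFn U) :
    vf (fun c' => if c' = c then 1 else 0) f = pd c f := by
  rw [vf, finsum_eq_single _ c]
  · simp
  · intro c' hc'; simp [hc']

theorem vf_coordFn (w : ι → SmoothFn U) (c : ι) : vf w (coordFn c) = w c := by
  classical
  rw [vf, finsum_eq_single _ c]
  · simp [pd_coordFn]
  · intro c' hc'; simp [pd_coordFn, hc']

theorem vf_eq_sum_of_pd_eq_sum {α : Type*} {A : Finset α} {g : SmoothFn U} {a f : α → SmoothFn U}
    (hg : ∀ c, pd c g = ∑ i ∈ A, a i * pd c (f i)) (w : ι → SmoothFn U) :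
    vf w g = ∑ i ∈ A, a i * vf w (f i) := by
  classical
  let T := supp g ∪ A.biUnion fun i => supp (f i)
  have hT : ∀ i ∈ A, vf w (f i) = ∑ c ∈ T, w c * pd c (f i) := fun i hi =>
    vf_eq_sum w (f i) ((Finset.subset_biUnion_of_mem (fun i => supp (f i)) hi).trans
      Finset.subset_union_right)
  rw [vf_eq_sum w g (T := T) Finset.subset_union_left,
    Finset.sum_congr (s₁ := A) rfl fun i hi => by rw [hT i hi, Finset.mul_sum], Finset.sum_comm]
  refine Finset.sum_congr rfl fun c _ => ?_
  rw [hg, Finset.mul_sum]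
  exact Finset.sum_congr rfl fun i _ => by ring

theorem pd_vf (c : ι) (w : ι → SmoothFn U) (f : SmoothFn U) :
    pd c (vf w f) = vf w (pd c f) + vf (fun c' => pd c (w c')) f := by
  rw [vf_eq_sum w f subset_rfl, vf_eq_sum w (pd c f) (supp_pd_subset c f),
    vf_eq_sum _ f subset_rfl, pd_sum, ← Finset.sum_add_distrib]
  exact Finset.sum_congr rfl fun c' _ => by rw [pd_mul, pd_comm c c']; ring

theorem pd_vf_of_pd_eq_zero {c : ι} {w : ι → SmoothFn U} (hw : ∀ c', pd c (w c') = 0)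
    (f : SmoothFn U) : pd c (vf w f) = vf w (pd c f) := by
  simp only [pd_vf, hw, vf_zero_left, add_zero]

open scoped Classical in
theorem pd_vf_of_pd_eq_ite {c b : ι} {w : ι → SmoothFn U}
    (hw : ∀ c', pd c (w c') = if c' = b then 1 else 0) (f : SmoothFn U) :
    pd c (vf w f) = vf w (pd c f) + pd b f := by
  simp only [pd_vf, hw, vf_indicator]

theorem vf_vf_eq_sum (w v : ι → SmoothFn U) (f : SmoothFn U) :
    vf w (vf v f) = ∑ c ∈ supp f, vf w (v c) * pd c f +
      ∑ c ∈ supp f, ∑ c' ∈ supp f, v c * w c' * pd c (pd c' f) := by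
  rw [vf_eq_sum v f subset_rfl, vf_sum, ← Finset.sum_add_distrib]
  refine Finset.sum_congr rfl fun c _ => ?_
  rw [vf_mul, vf_eq_sum w (pd c f) (supp_pd_subset c f), Finset.mul_sum, add_comm,
    mul_comm (pd c f)]
  exact congrArg _ (Finset.sum_congr rfl fun c' _ => by rw [pd_comm c c', mul_assoc])

theorem vf_comm {w v : ι → SmoothFn U} (hwv : ∀ c, vf w (v c) = vf v (w c)) (f : SmoothFn U) :
    vf w (vf v f) = vf v (vf w f) := by
  rw [vf_vf_eq_sum, vf_vf_eq_sum, Finset.sum_comm (s := supp f) (t := supp f)]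
  simp only [hwv]
  exact congrArg _ (Finset.sum_congr rfl fun c _ => Finset.sum_congr rfl fun c' _ => by
    rw [pd_comm c c', mul_comm (v c')])

end VectorFields

section Substitution

variable {ι κ : Type} {U : TopologicalSpace.Opens (ι → ℝ)} {V : TopologicalSpace.Opens (κ → ℝ)}
  (φ : κ → SmoothFn U) (hφ : ∀ θ : U, (fun c => (φ c).1 θ) ∈ V)

theorem subst_mem (f : SmoothFn V) :
    (fun θ : U => f.1 ⟨fun c => (φ c).1 θ, hφ θ⟩) ∈ SmoothFn U := by
  classical
  obtain ⟨S, g, hg⟩ := exists_represents f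
  choose T G hG using fun c => exists_represents (φ c)
  refine ⟨S.biUnion T, fun y => g fun c => G c.1 (Finset.restrict₂ (π := fun _ => ℝ)
    (Finset.subset_biUnion_of_mem T c.2) y), ?_, fun θ => ?_⟩
  · refine hg.contDiffOn.comp (contDiffOn_pi.2 fun c => (hG c.1).contDiffOn.comp
      (contDiff_pi.2 fun i => contDiff_apply ℝ ℝ _).contDiffOn ?_) ?_
    · rintro _ ⟨θ, hθ, rfl⟩
      exact ⟨θ, hθ, rfl⟩
    · rintro _ ⟨θ, hθ, rfl⟩
      exact ⟨fun c => (φ c).1 ⟨θ, hθ⟩, hφ ⟨θ, hθ⟩, funext fun c => (hG c.1).apply_eq ⟨θ, hθ⟩⟩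
  · exact (hg.apply_eq _).trans (congrArg g (funext fun c => (hG c.1).apply_eq θ))

/-- The substitution of the smooth functions `φ` on `U` for the coordinates of `V`. -/
def subst : SmoothFn V →ₐ[ℝ] SmoothFn U where
  toFun f := ⟨fun θ : U => f.1 ⟨fun c => (φ c).1 θ, hφ θ⟩, subst_mem φ hφ f⟩
  map_one' := rfl
  map_mul' _ _ := rfl
  map_zero' := rfl
  map_add' _ _ := rfl
  commutes' _ := rfl

theorem subst_apply (f : SmoothFn V) (θ : U) :
    (subst φ hφ f).1 θ = f.1 ⟨fun c => (φ c).1 θ, hφ θ⟩ := rfl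

theorem hasDerivAt_slice_subst {f : SmoothFn V} {S : Finset κ} {g : (S → ℝ) → ℝ}
    (hg : Represents S g f) (θ : U) (c : ι) :
    HasDerivAt (slice (subst φ hφ f).1 θ c)
      (fderiv ℝ g (S.restrict fun c' => (φ c').1 θ) fun c' => (pd c (φ c')).1 θ) (θ.1 c) := by
  have hinner : HasDerivAt (fun r (c' : S) => slice (φ c').1 θ c r)
      (fun c' => (pd c (φ c')).1 θ) (θ.1 c) :=
    hasDerivAt_pi.2 fun c' => hasDerivAt_slice _ _ _
  refine ((hg.hasFDerivAt ⟨_, hφ θ⟩).comp_hasDerivAt_of_eq (θ.1 c) hinner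
    (funext fun c' => (slice_self _ θ c).symm)).congr_of_eventuallyEq ?_
  filter_upwards [eventually_update_mem θ c] with r hr
  simp only [slice, hr, dite_true, Function.comp_apply, subst_apply, hg.apply_eq]
  rfl

theorem pd_subst (f : SmoothFn V) (c : ι) :
    pd c (subst φ hφ f) = ∑ c' ∈ supp f, subst φ hφ (pd c' f) * pd c (φ c') := by
  classical
  obtain ⟨S, g, hg⟩ := exists_represents f
  rw [Finset.sum_subset hg.supp_subset fun c' _ hc' => by
    rw [pd_eq_zero_of_notMem_supp hc', map_zero, zero_mul]]
  ext θ
  have hbasis : (fun c' : S => (pd c (φ c')).1 θ) =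
      ∑ c' : S, (pd c (φ c')).1 θ • unitVec S c'.1 := by
    ext i
    simp [Finset.sum_apply, unitVec_apply]
  rw [pd_apply_eq_of_hasDerivAt (hasDerivAt_slice_subst φ hφ hg θ c), hbasis, map_sum,
    AddSubmonoidClass.coe_finsetSum, Finset.sum_apply, ← Finset.sum_coe_sort S]
  refine Finset.sum_congr rfl fun c' _ => ?_
  rw [map_smul, smul_eq_mul, mul_comm]
  exact congrArg (· * _) ((hg.pd c'.1).apply_eq ⟨_, hφ θ⟩).symm

theorem vf_subst {w : ι → SmoothFn U} {v : κ → SmoothFn V}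
    (hwv : ∀ c, vf w (φ c) = subst φ hφ (v c)) (f : SmoothFn V) :
    vf w (subst φ hφ f) = subst φ hφ (vf v f) := by
  rw [vf_eq_sum_of_pd_eq_sum (pd_subst φ hφ f) w, vf_eq_sum v f subset_rfl, map_sum]
  exact Finset.sum_congr rfl fun c _ => by rw [map_mul, hwv, mul_comm]

end Substitution

/-! ### Total derivatives and the Euler operator -/

theorem multiIndex_induction {α : Type*} {P : (α →₀ ℕ) → Prop} (zero : P 0)
    (add_single : ∀ I j, P I → P (I + Finsupp.single j 1)) (I : α →₀ ℕ) : P I := by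
  suffices H : ∀ K I, P I → P (I + K) by simpa using H I 0 zero
  intro K
  induction K using Finsupp.induction_linear with
  | zero => simp
  | add K K' hK hK' => exact fun I hI => add_assoc I K K' ▸ hK' _ (hK _ hI)
  | single j b =>
    induction b with
    | zero => simp
    | succ b ih =>
      exact fun I hI => by simpa [Finsupp.single_add, add_assoc] using add_single _ j (ih I hI)

section TotalSpaceDerivatives

variable {n m : ℕ} {σ : Type} {U : TopologicalSpace.Opens (Coord n m σ → ℝ)}

/-- The components of the vector field `Dx j`. -/
def dxCoeff (j : Fin n) : Coord n m σ → SmoothFn U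
  | Coord.t => 0
  | Coord.x i => if i = j then 1 else 0
  | Coord.u k s I => coordFn (Coord.u k s (I + Finsupp.single j 1))

theorem Dx_eq_vf (j : Fin n) : (Dx j : SmoothFn U → SmoothFn U) = vf (dxCoeff j) := by
  unfold Dx
  congr 1

/-- The total derivative `Dx j` as a derivation. -/
def dxDerivation (j : Fin n) : Derivation ℝ (SmoothFn U) (SmoothFn U) := vfDerivation (dxCoeff j)

theorem coe_dxDerivation (j : Fin n) : ⇑(dxDerivation (U := U) j) = Dx j := (Dx_eq_vf j).symm

theorem Dx_zero (j : Fin n) : Dx j (0 : SmoothFn U) = 0 := by rw [← coe_dxDerivation, map_zero]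

theorem Dx_add (j : Fin n) (f g : SmoothFn U) : Dx j (f + g) = Dx j f + Dx j g := by
  rw [← coe_dxDerivation, map_add]

theorem Dx_mul (j : Fin n) (f g : SmoothFn U) : Dx j (f * g) = f * Dx j g + g * Dx j f := by
  rw [← coe_dxDerivation, Derivation.leibniz, smul_eq_mul, smul_eq_mul]

theorem Dx_coordFn (j : Fin n) (c : Coord n m σ) :
    Dx j (coordFn c : SmoothFn U) = dxCoeff j c := by
  rw [Dx_eq_vf, vf_coordFn]

theorem Dx_comm (i j : Fin n) (f : SmoothFn U) : Dx i (Dx j f) = Dx j (Dx i f) := by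
  rw [Dx_eq_vf, Dx_eq_vf]
  refine vf_comm (fun c => ?_) f
  cases c with
  | t => simp only [dxCoeff, vf_zero]
  | x l => simp only [dxCoeff]; split_ifs <;> simp only [vf_zero, vf_one]
  | u k s I => simp only [dxCoeff, vf_coordFn]; rw [add_right_comm]

theorem pd_Dx_add_single (j : Fin n) (k : Fin m) (s : σ) (K : Fin n →₀ ℕ) (f : SmoothFn U) :
    pd (Coord.u k s (K + Finsupp.single j 1)) (Dx j f) =
      Dx j (pd (Coord.u k s (K + Finsupp.single j 1)) f) + pd (Coord.u k s K) f := by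
  classical
  rw [Dx_eq_vf]
  refine pd_vf_of_pd_eq_ite (fun c => ?_) f
  cases c with
  | t => simp [dxCoeff, pd_zero]
  | x i => simp only [dxCoeff]; split_ifs <;> simp_all [pd_zero, pd_one]
  | u k' s' I =>
    simp only [dxCoeff, pd_coordFn, Coord.u.injEq, add_left_inj, eq_comm]

theorem pd_Dx_of_apply_eq_zero {j : Fin n} {K : Fin n →₀ ℕ} (hK : K j = 0) (k : Fin m) (s : σ)
    (f : SmoothFn U) : pd (Coord.u k s K) (Dx j f) = Dx j (pd (Coord.u k s K) f) := by
  classical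
  rw [Dx_eq_vf]
  refine pd_vf_of_pd_eq_zero (fun c => ?_) f
  cases c with
  | t => simp [dxCoeff, pd_zero]
  | x i => simp only [dxCoeff]; split_ifs <;> simp [pd_zero, pd_one]
  | u k' s' I =>
    have hne : K ≠ I + Finsupp.single j 1 := by rintro rfl; simp at hK
    simp [dxCoeff, pd_coordFn, hne]

theorem foldr_Dx_add_single (I : Fin n →₀ ℕ) (i : Fin n) (f : SmoothFn U) {l : List (Fin n)}
    (hl : l.Nodup) :
    l.foldr (fun j g => (Dx j)^[(I + Finsupp.single i 1 : Fin n →₀ ℕ) j] g) f =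
      if i ∈ l then Dx i (l.foldr (fun j g => (Dx j)^[I j] g) f)
      else l.foldr (fun j g => (Dx j)^[I j] g) f := by
  induction l with
  | nil => simp
  | cons a l ih =>
    obtain ⟨hal, hl⟩ := List.nodup_cons.1 hl
    rw [List.foldr_cons, List.foldr_cons, ih hl]
    obtain rfl | hia := eq_or_ne i a
    · simp [hal, Function.iterate_succ_apply']
    · have hcomm : Function.Commute (Dx a : SmoothFn U → SmoothFn U) (Dx i) := Dx_comm a i
      by_cases hil : i ∈ l
      · simpa [hia, hil] using (hcomm.iterate_left (I a)) _
      · simp [hia, hil]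

theorem DxI_zero_index (f : SmoothFn U) : DxI 0 f = f := by
  unfold DxI
  induction List.finRange n with
  | nil => rfl
  | cons a l ih => rw [List.foldr_cons, ih]; rfl

theorem DxI_add_single (I : Fin n →₀ ℕ) (i : Fin n) (f : SmoothFn U) :
    DxI (I + Finsupp.single i 1) f = Dx i (DxI I f) := by
  unfold DxI
  rw [foldr_Dx_add_single I i f (List.nodup_finRange n), if_pos (List.mem_finRange i)]

theorem DxI_comm_of_Dx_comm (I : Fin n →₀ ℕ) {P : SmoothFn U → SmoothFn U}
    (hP : ∀ j f, P (Dx j f) = Dx j (P f)) (f : SmoothFn U) : P (DxI I f) = DxI I (P f) := by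
  induction I using multiIndex_induction with
  | zero => simp only [DxI_zero_index]
  | add_single I j ih => rw [DxI_add_single, hP, ih, DxI_add_single]

theorem DxI_Dx (I : Fin n →₀ ℕ) (j : Fin n) (f : SmoothFn U) : DxI I (Dx j f) = Dx j (DxI I f) :=
  (DxI_comm_of_Dx_comm I (Dx_comm j) f).symm

/-- The iterated total derivative `DxI I` as a linear map. -/
def dxLinearMap (I : Fin n →₀ ℕ) : SmoothFn U →ₗ[ℝ] SmoothFn U where
  toFun := DxI I
  map_add' f g := by
    induction I using multiIndex_induction with
    | zero => simp only [DxI_zero_index]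
    | add_single I j ih => simp only [DxI_add_single, ih, Dx_add]
  map_smul' a f := by
    refine (DxI_comm_of_Dx_comm I (P := (a • ·)) (fun j f => ?_) f).symm
    exact coe_dxDerivation (U := U) j ▸ ((dxDerivation j).map_smul a f).symm

theorem DxI_zero (I : Fin n →₀ ℕ) : DxI I (0 : SmoothFn U) = 0 := (dxLinearMap I).map_zero

end TotalSpaceDerivatives

section TotalTimeDerivatives

variable {n m h : ℕ}

section FreeJets

variable {U : TopologicalSpace.Opens (Coord n m ℕ → ℝ)}

/-- The components of the vector field `Dt`. -/
def dtCoeff : Coord n m ℕ → SmoothFn U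
  | Coord.t => 1
  | Coord.x _ => 0
  | Coord.u k s I => coordFn (Coord.u k (s + 1) I)

theorem Dt_eq_vf : (Dt : SmoothFn U → SmoothFn U) = vf dtCoeff := by
  unfold Dt
  congr 1

/-- The total derivative `Dt` as a derivation. -/
def dtDerivation : Derivation ℝ (SmoothFn U) (SmoothFn U) := vfDerivation dtCoeff

theorem coe_dtDerivation : ⇑(dtDerivation (U := U)) = Dt := Dt_eq_vf.symm

theorem Dt_mul (f g : SmoothFn U) : Dt (f * g) = f * Dt g + g * Dt f := by
  rw [← coe_dtDerivation, Derivation.leibniz, smul_eq_mul, smul_eq_mul]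

theorem Dt_Dx_comm (j : Fin n) (f : SmoothFn U) : Dt (Dx j f) = Dx j (Dt f) := by
  rw [Dt_eq_vf, Dx_eq_vf]
  refine vf_comm (fun c => ?_) f
  cases c with
  | t => simp only [dxCoeff, dtCoeff, vf_zero, vf_one]
  | x l => simp only [dxCoeff, dtCoeff]; split_ifs <;> simp only [vf_zero, vf_one]
  | u k s I => simp only [dxCoeff, dtCoeff, vf_coordFn]

theorem pd_Dt_succ (k : Fin m) (s : ℕ) (K : Fin n →₀ ℕ) (f : SmoothFn U) :
    pd (Coord.u k (s + 1) K) (Dt f) =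
      Dt (pd (Coord.u k (s + 1) K) f) + pd (Coord.u k s K) f := by
  classical
  rw [Dt_eq_vf]
  refine pd_vf_of_pd_eq_ite (fun c => ?_) f
  cases c with
  | t => simp [dtCoeff, pd_one]
  | x i => simp [dtCoeff, pd_zero]
  | u k' s' I => simp only [dtCoeff, pd_coordFn, Coord.u.injEq, add_left_inj, eq_comm]

theorem pd_Dt_zero (k : Fin m) (K : Fin n →₀ ℕ) (f : SmoothFn U) :
    pd (Coord.u k 0 K) (Dt f) = Dt (pd (Coord.u k 0 K) f) := by
  classical
  rw [Dt_eq_vf]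
  refine pd_vf_of_pd_eq_zero (fun c => ?_) f
  cases c with
  | t => simp [dtCoeff, pd_one]
  | x i => simp [dtCoeff, pd_zero]
  | u k' s' I => simp [dtCoeff, pd_coordFn]

end FreeJets

section Solutions

variable {U : TopologicalSpace.Opens (Coord n m (Fin h) → ℝ)} (F : Fin m → SmoothFn U)

/-- The components of the vector field `DtBar F`. -/
def dtBarCoeff : Coord n m (Fin h) → SmoothFn U
  | Coord.t => 1
  | Coord.x _ => 0
  | Coord.u k s I =>
      if hs : s.1 + 1 < h then coordFn (Coord.u k ⟨s.1 + 1, hs⟩ I) else DxI I (F k)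

theorem DtBar_eq_vf : DtBar F = vf (dtBarCoeff F) := by
  unfold DtBar
  congr 1

/-- The restricted total derivative `DtBar F` as a derivation. -/
def dtBarDerivation : Derivation ℝ (SmoothFn U) (SmoothFn U) := vfDerivation (dtBarCoeff F)

theorem coe_dtBarDerivation : ⇑(dtBarDerivation F) = DtBar F := (DtBar_eq_vf F).symm

theorem DtBar_coordFn (c : Coord n m (Fin h)) : DtBar F (coordFn c) = dtBarCoeff F c := by
  rw [DtBar_eq_vf, vf_coordFn]

theorem DtBar_Dx_comm (j : Fin n) (f : SmoothFn U) : DtBar F (Dx j f) = Dx j (DtBar F f) := by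
  suffices hcomm : vf (dtBarCoeff F) (vf (dxCoeff j) f) = vf (dxCoeff j) (vf (dtBarCoeff F) f) by
    rw [DtBar_eq_vf, Dx_eq_vf, hcomm]
  refine vf_comm (fun c => ?_) f
  cases c with
  | t => simp only [dxCoeff, dtBarCoeff, vf_zero, vf_one]
  | x l => simp only [dxCoeff, dtBarCoeff]; split_ifs <;> simp only [vf_zero, vf_one]
  | u k s I =>
    simp only [dxCoeff, dtBarCoeff, vf_coordFn]
    split_ifs with hs
    · simp only [vf_coordFn, dxCoeff]
    · rw [DxI_add_single, Dx_eq_vf]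

theorem DtBar_DxI_comm (I : Fin n →₀ ℕ) (f : SmoothFn U) :
    DtBar F (DxI I f) = DxI I (DtBar F f) :=
  DxI_comm_of_Dx_comm I (DtBar_Dx_comm F) f

end Solutions

end TotalTimeDerivatives

section FormalAdjoint

variable {n m : ℕ} {σ : Type} {U : TopologicalSpace.Opens (Coord n m σ → ℝ)}
  (D : Derivation ℝ (SmoothFn U) (SmoothFn U))

/-- The operator `(-1)^{s+|I|} D^s D_x^I` for `p = (s, I)`. When `D` is `Dt` or `DtBar F`, this is
the formal adjoint of `D^s D_x^I`. -/
def adjointOp (p : ℕ × (Fin n →₀ ℕ)) : SmoothFn U →ₗ[ℝ] SmoothFn U :=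
  LinearMap.mulLeft ℝ ((-1) ^ (p.1 + p.2.degree)) ∘ₗ
    (D.toLinearMap ^ p.1) ∘ₗ dxLinearMap p.2

theorem adjointOp_apply (p : ℕ × (Fin n →₀ ℕ)) (f : SmoothFn U) :
    adjointOp D p f = (-1) ^ (p.1 + p.2.degree) * D^[p.1] (DxI p.2 f) := by
  rw [adjointOp, LinearMap.comp_apply, LinearMap.comp_apply, Module.End.pow_apply]
  rfl

theorem adjointOp_zero (f : SmoothFn U) : adjointOp D 0 f = f := by
  simp [adjointOp_apply, DxI_zero_index]

theorem adjointOp_add_single (s : ℕ) (I : Fin n →₀ ℕ) (j : Fin n) (f : SmoothFn U) :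
    adjointOp D (s, I + Finsupp.single j 1) f = -adjointOp D (s, I) (Dx j f) := by
  simp only [adjointOp_apply, DxI_add_single, DxI_Dx, map_add, Finsupp.degree_single]
  ring

variable {D} in
theorem adjointOp_succ (hD : ∀ j f, D (Dx j f) = Dx j (D f)) (s : ℕ) (I : Fin n →₀ ℕ)
    (f : SmoothFn U) : adjointOp D (s + 1, I) f = -adjointOp D (s, I) (D f) := by
  simp only [adjointOp_apply, Function.iterate_succ_apply, DxI_comm_of_Dx_comm I hD]
  ring

end FormalAdjoint

section EulerOperator

variable {n m : ℕ} {V : TopologicalSpace.Opens (Coord n m ℕ → ℝ)}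

/-- The family of the partial derivatives `∂f/∂u^k_{s,I}`, indexed by the pairs `(s, I)`. -/
def jetGrad (k : Fin m) (f : SmoothFn V) : (ℕ × (Fin n →₀ ℕ)) →₀ SmoothFn V :=
  Finsupp.ofSupportFinite (fun p => pd (Coord.u k p.1 p.2) f) <|
    (finite_pd_ne_zero f).preimage (f := fun p : ℕ × (Fin n →₀ ℕ) => Coord.u k p.1 p.2)
      fun _ _ _ _ hp => by simpa [Prod.ext_iff] using hp

theorem jetGrad_apply (k : Fin m) (f : SmoothFn V) (p : ℕ × (Fin n →₀ ℕ)) :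
    jetGrad k f p = pd (Coord.u k p.1 p.2) f := rfl

/-- The Euler operator `∑ (-1)^{s+|I|} D_t^s D_x^I ∘ ∂/∂u^k_{s,I}`, that is, the variational
derivative with respect to `u^k`. -/
def euler (k : Fin m) : SmoothFn V →+ SmoothFn V where
  toFun f := (jetGrad k f).sum fun p c => adjointOp dtDerivation p c
  map_zero' := by
    have hzero : jetGrad k (0 : SmoothFn V) = 0 := by ext1 p; exact pd_zero _
    rw [hzero, Finsupp.sum_zero_index]
  map_add' f g := by
    have hadd : jetGrad k (f + g) = jetGrad k f + jetGrad k g := by ext1 p; exact pd_add _ f g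
    rw [hadd, Finsupp.sum_add_index' (fun _ => map_zero _) fun _ => map_add _]

theorem euler_apply (k : Fin m) (f : SmoothFn V) :
    euler k f = (jetGrad k f).sum fun p c => adjointOp dtDerivation p c := rfl

variable {D : Derivation ℝ (SmoothFn V) (SmoothFn V)} {τ : ℕ × (Fin n →₀ ℕ) → ℕ × (Fin n →₀ ℕ)}

theorem jetGrad_eq_of_shift (hτ : τ.Injective) {k : Fin m} {f : SmoothFn V}
    (hmem : ∀ p, jetGrad k (D f) (τ p) = D (jetGrad k f (τ p)) + jetGrad k f p)
    (hnotMem : ∀ p ∉ Set.range τ, jetGrad k (D f) p = D (jetGrad k f p)) :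
    jetGrad k (D f) = (jetGrad k f).mapRange D D.map_zero + (jetGrad k f).mapDomain τ := by
  ext1 p
  rw [Finsupp.add_apply, Finsupp.mapRange_apply]
  by_cases hp : p ∈ Set.range τ
  · obtain ⟨p, rfl⟩ := hp
    rw [hmem, Finsupp.mapDomain_apply hτ]
  · rw [hnotMem p hp, Finsupp.mapDomain_of_notMem_range _ _ hp, add_zero]

/-- A total derivative `D` shifts the jet coordinates by `τ`, and passing to adjoints turns the
shift into `-D`, so that the two parts of the gradient of `D f` cancel. -/
theorem euler_eq_zero_of_shift (hτ : τ.Injective) {k : Fin m} {f : SmoothFn V}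
    (hmem : ∀ p, jetGrad k (D f) (τ p) = D (jetGrad k f (τ p)) + jetGrad k f p)
    (hnotMem : ∀ p ∉ Set.range τ, jetGrad k (D f) p = D (jetGrad k f p))
    (hadj : ∀ p (g : SmoothFn V),
      adjointOp dtDerivation (τ p) g = -adjointOp dtDerivation p (D g)) :
    euler k (D f) = 0 := by
  rw [euler_apply, jetGrad_eq_of_shift hτ hmem hnotMem,
    Finsupp.sum_add_index' (fun _ => map_zero _) fun _ => map_add _,
    Finsupp.sum_mapRange_index fun _ => map_zero _,
    Finsupp.sum_mapDomain_index (fun _ => map_zero _) fun _ => map_add _, Finsupp.sum, Finsupp.sum,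
    ← Finset.sum_add_distrib]
  exact Finset.sum_eq_zero fun p _ => by rw [hadj, add_neg_cancel]

theorem exists_eq_add_single {ι : Type*} {K : ι →₀ ℕ} {j : ι} (hK : K j ≠ 0) :
    ∃ I, K = I + Finsupp.single j 1 :=
  ⟨K - Finsupp.single j 1,
    (tsub_add_cancel_of_le (Finsupp.single_le_iff.2 (Nat.one_le_iff_ne_zero.2 hK))).symm⟩

theorem euler_Dx (k : Fin m) (j : Fin n) (f : SmoothFn V) : euler k (Dx j f) = 0 := by
  rw [← coe_dxDerivation]
  refine euler_eq_zero_of_shift (τ := fun p => (p.1, p.2 + Finsupp.single j 1)) ?_ ?_ ?_ ?_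
  · exact fun p q hpq => by simpa [Prod.ext_iff] using hpq
  · exact fun p => by simp only [coe_dxDerivation, jetGrad_apply, pd_Dx_add_single]
  · rintro ⟨s, K⟩ hK
    have hKj : K j = 0 := by
      by_contra hKj
      obtain ⟨I, rfl⟩ := exists_eq_add_single hKj
      exact hK ⟨(s, I), rfl⟩
    simp only [coe_dxDerivation, jetGrad_apply, pd_Dx_of_apply_eq_zero hKj]
  · exact fun p g => by rw [coe_dxDerivation, adjointOp_add_single]

theorem euler_Dt (k : Fin m) (f : SmoothFn V) : euler k (Dt f) = 0 := by
  rw [← coe_dtDerivation]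
  refine euler_eq_zero_of_shift (τ := fun p => (p.1 + 1, p.2)) ?_ ?_ ?_ ?_
  · exact fun p q hpq => by simpa [Prod.ext_iff] using hpq
  · exact fun p => by simp only [coe_dtDerivation, jetGrad_apply, pd_Dt_succ]
  · rintro ⟨_ | s, K⟩ hK
    · simp only [coe_dtDerivation, jetGrad_apply, pd_Dt_zero]
    · exact absurd ⟨(s, K), rfl⟩ hK
  · exact fun p g => adjointOp_succ (by simpa only [coe_dtDerivation] using Dt_Dx_comm) p.1 p.2 g

theorem euler_mul_Dx (k : Fin m) (j : Fin n) (f g : SmoothFn V) :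
    euler k (g * Dx j f) = euler k (-Dx j g * f) := by
  rw [show g * Dx j f = Dx j (g * f) + -Dx j g * f by rw [Dx_mul]; ring, map_add, euler_Dx,
    zero_add]

theorem euler_mul_Dt (k : Fin m) (f g : SmoothFn V) :
    euler k (g * Dt f) = euler k (-Dt g * f) := by
  rw [show g * Dt f = Dt (g * f) + -Dt g * f by rw [Dt_mul]; ring, map_add, euler_Dt, zero_add]

theorem euler_mul_iterate_Dt_DxI (k : Fin m) (s : ℕ) (I : Fin n →₀ ℕ) (g f : SmoothFn V) :
    euler k (g * Dt^[s] (DxI I f)) = euler k (adjointOp dtDerivation (s, I) g * f) := by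
  induction s generalizing g with
  | zero =>
    rw [Function.iterate_zero_apply]
    induction I using multiIndex_induction generalizing g with
    | zero => rw [DxI_zero_index]; exact congrArg (euler k <| · * f) (adjointOp_zero _ g).symm
    | add_single I j ih =>
      rw [DxI_add_single, euler_mul_Dx, ih, adjointOp_add_single, map_neg]
  | succ s ih =>
    rw [Function.iterate_succ_apply', euler_mul_Dt, ih,
      adjointOp_succ (by simpa only [coe_dtDerivation] using Dt_Dx_comm), map_neg, coe_dtDerivation]

end EulerOperator

/-! ### Restriction to solutions -/

section Restriction

variable {n m h : ℕ} {U : TopologicalSpace.Opens (Coord n m (Fin h) → ℝ)} (F : Fin m → SmoothFn U)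

/-- The jet coordinates, expressed on the solutions of the system by the coordinates with
`s < h`. -/
def solutionCoord : Coord n m ℕ → SmoothFn U
  | Coord.t => coordFn Coord.t
  | Coord.x j => coordFn (Coord.x j)
  | Coord.u k s I =>
      if hs : s < h then coordFn (Coord.u k ⟨s, hs⟩ I) else DxI I ((DtBar F)^[s - h] (F k))

theorem solutionCoord_comp_incl (θ : U) :
    (fun c => (solutionCoord F c).1 θ) ∘ Coord.incl = θ.1 := by
  funext c
  cases c with
  | t => rfl
  | x j => rfl
  | u k s I => simp [Coord.incl, solutionCoord, coordFn]

theorem solutionCoord_mem_fullJets (θ : U) :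
    (fun c => (solutionCoord F c).1 θ) ∈ fullJets U := by
  change (fun c => (solutionCoord F c).1 θ) ∘ Coord.incl ∈ U
  rw [solutionCoord_comp_incl]
  exact θ.2

/-- Restriction of functions on the space of all jets to the solutions of the system; this is the
reduction modulo `eqnIdeal F`. -/
def restrictJets : SmoothFn (fullJets U) →ₐ[ℝ] SmoothFn U :=
  subst (solutionCoord F) (solutionCoord_mem_fullJets F)

theorem restrictJets_coordFn (c : Coord n m ℕ) :
    restrictJets F (coordFn c) = solutionCoord F c := rfl

theorem restrictJets_lift (f : SmoothFn U) : restrictJets F (lift f) = f := by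
  ext θ
  exact congrArg f.1 (Subtype.ext (solutionCoord_comp_incl F θ))

theorem restrictJets_Dx (j : Fin n) (f : SmoothFn (fullJets U)) :
    restrictJets F (Dx j f) = Dx j (restrictJets F f) := by
  rw [Dx_eq_vf, Dx_eq_vf]
  refine (vf_subst _ (solutionCoord_mem_fullJets F) (fun c => ?_) f).symm
  rw [← Dx_eq_vf]
  change Dx j (solutionCoord F c) = restrictJets F (dxCoeff j c)
  cases c with
  | t => rw [solutionCoord, Dx_coordFn]; exact (map_zero _).symm
  | x i => rw [solutionCoord, Dx_coordFn]; simp only [dxCoeff]; split_ifs <;> simp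
  | u k s I =>
    simp only [dxCoeff, restrictJets_coordFn, solutionCoord]
    split_ifs
    · rw [Dx_coordFn]; rfl
    · rw [DxI_add_single]

theorem restrictJets_Dt (f : SmoothFn (fullJets U)) :
    restrictJets F (Dt f) = DtBar F (restrictJets F f) := by
  rw [Dt_eq_vf, DtBar_eq_vf]
  refine (vf_subst _ (solutionCoord_mem_fullJets F) (fun c => ?_) f).symm
  rw [← DtBar_eq_vf]
  change DtBar F (solutionCoord F c) = restrictJets F (dtCoeff c)
  cases c with
  | t => rw [solutionCoord, DtBar_coordFn]; exact (map_one _).symm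
  | x i => rw [solutionCoord, DtBar_coordFn]; exact (map_zero _).symm
  | u k s I =>
    simp only [dtCoeff, restrictJets_coordFn, solutionCoord]
    by_cases hs : s < h
    · rw [dif_pos hs, DtBar_coordFn]
      simp only [dtBarCoeff]
      split_ifs
      · rfl
      · rw [show s + 1 - h = 0 by omega, Function.iterate_zero_apply]
    · rw [dif_neg hs, dif_neg (by omega), DtBar_DxI_comm, ← Function.iterate_succ_apply' (DtBar F),
        show s + 1 - h = (s - h).succ by omega]

theorem restrictJets_DxI (I : Fin n →₀ ℕ) (f : SmoothFn (fullJets U)) :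
    restrictJets F (DxI I f) = DxI I (restrictJets F f) := by
  induction I using multiIndex_induction with
  | zero => simp only [DxI_zero_index]
  | add_single I j ih => rw [DxI_add_single, DxI_add_single, restrictJets_Dx, ih]

theorem restrictJets_iterate_Dt (s : ℕ) (f : SmoothFn (fullJets U)) :
    restrictJets F (Dt^[s] f) = (DtBar F)^[s] (restrictJets F f) :=
  (Function.Semiconj.iterate_right (restrictJets_Dt F) s) f

theorem restrictJets_adjointOp (p : ℕ × (Fin n →₀ ℕ)) (f : SmoothFn (fullJets U)) :
    restrictJets F (adjointOp dtDerivation p f) =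
      adjointOp (dtBarDerivation F) p (restrictJets F f) := by
  rw [adjointOp_apply, adjointOp_apply, coe_dtDerivation, coe_dtBarDerivation, map_mul,
    restrictJets_iterate_Dt, restrictJets_DxI, map_pow, map_neg, map_one]

theorem restrictJets_eqn (k : Fin m) : restrictJets F (eqn F k) = 0 := by
  rw [eqn, map_sub, restrictJets_lift, restrictJets_coordFn]
  simp [solutionCoord, DxI_zero_index]

variable {F} in
theorem restrictJets_eq_zero {f : SmoothFn (fullJets U)} (hf : f ∈ eqnIdeal F) :
    restrictJets F f = 0 := by
  suffices hker : eqnIdeal F ≤ RingHom.ker (restrictJets F) from RingHom.mem_ker.1 (hker hf)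
  refine Ideal.span_le.2 ?_
  rintro _ ⟨k, s, I, rfl⟩
  rw [SetLike.mem_coe, RingHom.mem_ker, restrictJets_iterate_Dt, restrictJets_DxI,
    restrictJets_eqn, DxI_zero, ← coe_dtBarDerivation, iterate_map_zero]

theorem Coord.incl_injective :
    Function.Injective (Coord.incl : Coord n m (Fin h) → Coord n m ℕ) := by
  intro c c' hc
  cases c <;> cases c' <;> simp_all [Coord.incl, Fin.val_inj]

theorem coordFn_incl_mem (θ : fullJets U) :
    (fun c : Coord n m (Fin h) => (coordFn c.incl : SmoothFn (fullJets U)).1 θ) ∈ U := θ.2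

theorem lift_eq_subst (f : SmoothFn U) :
    lift f = subst (V := U) (U := fullJets U) (fun c => coordFn c.incl) coordFn_incl_mem f := rfl

theorem pd_incl_lift (c : Coord n m (Fin h)) (f : SmoothFn U) :
    pd c.incl (lift f) = lift (pd c f) := by
  classical
  rw [lift_eq_subst, pd_subst, lift_eq_subst]
  simp only [pd_coordFn, Coord.incl_injective.eq_iff, mul_ite, mul_one, mul_zero,
    Finset.sum_ite_eq]
  split_ifs with hc
  · rfl
  · rw [pd_eq_zero_of_notMem_supp hc, map_zero]

theorem pd_lift_of_notMem_range {c : Coord n m ℕ}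
    (hc : c ∉ Set.range (Coord.incl : Coord n m (Fin h) → Coord n m ℕ)) (f : SmoothFn U) :
    pd c (lift f) = 0 := by
  classical
  rw [lift_eq_subst, pd_subst]
  refine Finset.sum_eq_zero fun c' _ => ?_
  rw [pd_coordFn, if_neg fun hcc' => hc ⟨c', hcc'.symm⟩, mul_zero]

theorem restrictJets_pd_lift (k : Fin m) (s : ℕ) (I : Fin n →₀ ℕ) (f : SmoothFn U) :
    restrictJets F (pd (Coord.u k s I) (lift f)) = pdu k s I f := by
  by_cases hs : s < h
  · have hlift := pd_incl_lift (Coord.u k ⟨s, hs⟩ I) f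
    rw [Coord.incl] at hlift
    rw [hlift, restrictJets_lift, pdu, dif_pos hs]
  · have hnotMem : Coord.u k s I ∉ Set.range (Coord.incl : Coord n m (Fin h) → Coord n m ℕ) := by
      rintro ⟨_ | _ | ⟨_, s', _⟩, hc⟩ <;> simp only [Coord.incl, reduceCtorEq, Coord.u.injEq] at hc
      exact hs (hc.2.1 ▸ s'.2)
    rw [pd_lift_of_notMem_range hnotMem, map_zero, pdu, dif_neg hs]

open Classical in
theorem restrictJets_pd_eqn (k l : Fin m) (p : ℕ × (Fin n →₀ ℕ)) :
    restrictJets F (pd (Coord.u k p.1 p.2) (eqn F l)) =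
      (if k = l ∧ p = (h, 0) then 1 else 0) - pdu k p.1 p.2 (F l) := by
  rw [eqn, pd_sub, map_sub, restrictJets_pd_lift, pd_coordFn, apply_ite (restrictJets F), map_one,
    map_zero]
  simp only [Coord.u.injEq, Prod.ext_iff]

end Restriction

section CharacteristicEquation

variable {n m h : ℕ} {U : TopologicalSpace.Opens (Coord n m (Fin h) → ℝ)} {F : Fin m → SmoothFn U}

theorem finite_pdu_ne_zero (k : Fin m) (f : SmoothFn U) :
    {p : ℕ × (Fin n →₀ ℕ) | pdu k p.1 p.2 f ≠ 0}.Finite := by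
  have hfin : {q : Fin h × (Fin n →₀ ℕ) | pd (Coord.u k q.1 q.2) f ≠ 0}.Finite :=
    (finite_pd_ne_zero f).preimage (f := fun q : Fin h × (Fin n →₀ ℕ) => Coord.u k q.1 q.2)
      fun _ _ _ _ hq => by simpa [Prod.ext_iff] using hq
  refine (hfin.image fun q => (q.1.1, q.2)).subset ?_
  rintro ⟨s, I⟩ hp
  obtain ⟨hs, hpd⟩ : ∃ hs : s < h, pd (Coord.u k ⟨s, hs⟩ I) f ≠ 0 := by
    simpa only [pdu, Set.mem_ofPred_eq, ne_eq, dite_eq_right_iff, not_forall] using hp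
  exact ⟨(⟨s, hs⟩, I), hpd, rfl⟩

theorem hasFiniteSupport_adjointOp_pdu_mul (k : Fin m) (f ψ : SmoothFn U) :
    Function.HasFiniteSupport fun p : ℕ × (Fin n →₀ ℕ) =>
      adjointOp (dtBarDerivation F) p (pdu k p.1 p.2 f * ψ) :=
  (finite_pdu_ne_zero k f).subset fun p hp hpdu => hp <| by
    simp only [hpdu, zero_mul, map_zero]

theorem finsum_adjointOp_pdu_mul_eq_adjL (hF : IsGenEvolution F) (k l : Fin m) (ψ : SmoothFn U) :
    ∑ᶠ p : ℕ × (Fin n →₀ ℕ), adjointOp (dtBarDerivation F) p (pdu k p.1 p.2 (F l) * ψ) =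
      adjL F k l ψ := by
  rw [finsum_curry _ (hasFiniteSupport_adjointOp_pdu_mul k (F l) ψ),
    finsum_eq_sum_of_support_subset (s := insert 0 (Finset.Ico 1 h)), Finset.sum_insert (by simp),
    adjL]
  · congr 1
    · exact finsum_congr fun I => by simp [adjointOp_apply]
    · refine Finset.sum_congr rfl fun s hs => ?_
      rw [finsum_eq_single _ 0 fun I hI => ?_]
      · simp [adjointOp_apply, coe_dtBarDerivation, DxI_zero_index]
      · rw [hF l k s I (by simp at hs; omega) hI, zero_mul, map_zero]
  · refine Function.support_subset_iff'.2 fun s hs => ?_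
    have hsh : ¬s < h := by simp at hs; omega
    simp only [pdu, dif_neg hsh, zero_mul, map_zero, finsum_zero]

variable (F) in
theorem restrictJets_euler (k : Fin m) (f : SmoothFn (fullJets U)) :
    restrictJets F (euler k f) = ∑ᶠ p : ℕ × (Fin n →₀ ℕ),
      adjointOp (dtBarDerivation F) p (restrictJets F (pd (Coord.u k p.1 p.2) f)) := by
  rw [euler_apply, Finsupp.sum, map_sum,
    finsum_eq_sum_of_support_subset (s := (jetGrad k f).support)]
  · exact Finset.sum_congr rfl fun p _ => restrictJets_adjointOp F p _
  · refine Function.support_subset_iff'.2 fun p hp => ?_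
    have hpd : pd (Coord.u k p.1 p.2) f = 0 := by simpa [jetGrad_apply] using hp
    rw [hpd, map_zero, map_zero]

open Classical in
variable (F) in
theorem restrictJets_pd_sum_mul_eqn (k : Fin m) (p : ℕ × (Fin n →₀ ℕ))
    (G : Fin m → SmoothFn (fullJets U)) :
    restrictJets F (pd (Coord.u k p.1 p.2) (∑ l, G l * eqn F l)) =
      (if p = (h, 0) then restrictJets F (G k) else 0) -
        ∑ l, pdu k p.1 p.2 (F l) * restrictJets F (G l) := by
  simp only [pd_sum, map_sum, pd_mul, map_add, map_mul, restrictJets_eqn, zero_mul, add_zero,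
    restrictJets_pd_eqn, mul_sub, Finset.sum_sub_distrib, ite_and, mul_ite, mul_one, mul_zero,
    Finset.sum_ite_eq, Finset.mem_univ, if_true, mul_comm (pdu _ _ _ _)]

theorem restrictJets_euler_sum_mul_eqn (hF : IsGenEvolution F) (k : Fin m)
    (G : Fin m → SmoothFn (fullJets U)) :
    restrictJets F (euler k (∑ l, G l * eqn F l)) =
      (-1) ^ h * (DtBar F)^[h] (restrictJets F (G k)) -
        ∑ l, adjL F k l (restrictJets F (G l)) := by
  classical
  rw [restrictJets_euler]
  simp only [restrictJets_pd_sum_mul_eqn, map_sub, map_sum (adjointOp _ _)]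
  rw [finsum_sub_distrib, finsum_sum_comm, finsum_eq_single _ (h, 0) fun p hp => by
    rw [if_neg hp, map_zero]]
  · simp only [if_true, adjointOp_apply, coe_dtBarDerivation, DxI_zero_index, map_zero, add_zero]
    simp only [← finsum_adjointOp_pdu_mul_eq_adjL hF, adjointOp_apply, coe_dtBarDerivation]
  · exact fun l _ => hasFiniteSupport_adjointOp_pdu_mul k (F l) _
  · refine (Set.finite_singleton (h, 0)).subset fun p hp => by_contra fun hne => hp ?_
    simp only [if_neg (Set.notMem_singleton_iff.1 hne), map_zero]
  · refine (Set.finite_iUnion fun l =>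
      hasFiniteSupport_adjointOp_pdu_mul (F := F) k (F l) (restrictJets F (G l))).subset ?_
    intro p hp
    obtain ⟨l, -, hl⟩ := Finset.exists_ne_zero_of_sum_ne_zero hp
    exact Set.mem_iUnion.2 ⟨l, hl⟩

theorem euler_divergence (k : Fin m) {V : TopologicalSpace.Opens (Coord n m ℕ → ℝ)}
    (K₀ : SmoothFn V) (K : Fin n → SmoothFn V) : euler k (Dt K₀ + ∑ i, Dx i (K i)) = 0 := by
  rw [map_add, euler_Dt, map_sum, Finset.sum_eq_zero fun i _ => euler_Dx k i (K i), add_zero]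

theorem IsCharacteristic.equation (hF : IsGenEvolution F) {J₀ : SmoothFn U}
    {J : Fin n → SmoothFn U} {χ : Fin m → SmoothFn U} (hχ : IsCharacteristic F J₀ J χ)
    (k : Fin m) : (-1) ^ h * (DtBar F)^[h] (χ k) = ∑ l, adjL F k l (χ l) := by
  obtain ⟨K₀, K, g, -, -, hdiv, hg⟩ := hχ
  let G : Fin m → SmoothFn (fullJets U) := fun k => (g k).sum fun p c => adjointOp dtDerivation p c
  have hGχ (l : Fin m) : restrictJets F (G l) = χ l := by
    have hzero := restrictJets_eq_zero (hg l)
    rw [map_sub, restrictJets_lift, sub_eq_zero] at hzero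
    rw [← hzero]
    simp only [G, adjointOp_apply, coe_dtDerivation]
  have heuler : euler k (∑ l, G l * eqn F l) = 0 := by
    rw [← euler_divergence k K₀ K, hdiv]
    simp only [G, Finsupp.sum, Finset.sum_mul, map_sum, euler_mul_iterate_Dt_DxI]
  have hrestrict := restrictJets_euler_sum_mul_eqn hF k G
  simp only [heuler, map_zero, hGχ] at hrestrict
  exact sub_eq_zero.1 hrestrict.symm

end CharacteristicEquation

/-! ### Order estimates -/

section JetSupport

variable {n m h : ℕ} {U : TopologicalSpace.Opens (Coord n m (Fin h) → ℝ)}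

/-- The partial derivative `pdu k s K` as a derivation. -/
def pduDerivation (k : Fin m) (s : ℕ) (K : Fin n →₀ ℕ) : Derivation ℝ (SmoothFn U) (SmoothFn U) :=
  if hs : s < h then pdDerivation (Coord.u k ⟨s, hs⟩ K) else 0

theorem coe_pduDerivation (k : Fin m) (s : ℕ) (K : Fin n →₀ ℕ) :
    ⇑(pduDerivation (U := U) k s K) = pdu k s K := by
  ext1 f
  unfold pduDerivation pdu
  split_ifs <;> rfl

theorem pdu_val (k : Fin m) (s : Fin h) (K : Fin n →₀ ℕ) (f : SmoothFn U) :
    pdu k s K f = pd (Coord.u k s K) f := by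
  simp [pdu]

theorem pdu_of_le {k : Fin m} {s : ℕ} (hs : h ≤ s) (K : Fin n →₀ ℕ) (f : SmoothFn U) :
    pdu k s K f = 0 := by
  simp [pdu, hs]

theorem pdu_zero (k : Fin m) (s : ℕ) (K : Fin n →₀ ℕ) : pdu k s K (0 : SmoothFn U) = 0 := by
  rw [← coe_pduDerivation, map_zero]

theorem pdu_one (k : Fin m) (s : ℕ) (K : Fin n →₀ ℕ) : pdu k s K (1 : SmoothFn U) = 0 := by
  rw [← coe_pduDerivation, Derivation.map_one_eq_zero]

theorem pdu_mul (k : Fin m) (s : ℕ) (K : Fin n →₀ ℕ) (f g : SmoothFn U) :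
    pdu k s K (f * g) = f * pdu k s K g + g * pdu k s K f := by
  simp only [← coe_pduDerivation, Derivation.leibniz, smul_eq_mul]

theorem pdu_sum {α : Type*} (k : Fin m) (s : ℕ) (K : Fin n →₀ ℕ) (S : Finset α)
    (f : α → SmoothFn U) : pdu k s K (∑ a ∈ S, f a) = ∑ a ∈ S, pdu k s K (f a) := by
  simp only [← coe_pduDerivation, map_sum]

theorem pdu_comm (k k' : Fin m) (s s' : ℕ) (K K' : Fin n →₀ ℕ) (f : SmoothFn U) :
    pdu k s K (pdu k' s' K' f) = pdu k' s' K' (pdu k s K f) := by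
  by_cases hs : s < h
  · by_cases hs' : s' < h
    · simp only [pdu, dif_pos hs, dif_pos hs', pd_comm]
    · rw [pdu_of_le (not_lt.1 hs'), pdu_of_le (not_lt.1 hs'), pdu_zero]
  · rw [pdu_of_le (not_lt.1 hs), pdu_of_le (not_lt.1 hs), pdu_zero]

open scoped Classical in
theorem pdu_coordFn_u (k k' : Fin m) (s : ℕ) (s' : Fin h) (K K' : Fin n →₀ ℕ) :
    pdu k s K (coordFn (Coord.u k' s' K') : SmoothFn U) =
      if k' = k ∧ (s' : ℕ) = s ∧ K' = K then 1 else 0 := by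
  by_cases hs : s < h
  · simp [pdu, dif_pos hs, pd_coordFn, Fin.ext_iff, eq_comm]
  · rw [pdu_of_le (not_lt.1 hs), if_neg]
    have := s'.2
    omega

theorem pdu_Dx_add_single (j : Fin n) (k : Fin m) (s : ℕ) (K : Fin n →₀ ℕ) (f : SmoothFn U) :
    pdu k s (K + Finsupp.single j 1) (Dx j f) =
      Dx j (pdu k s (K + Finsupp.single j 1) f) + pdu k s K f := by
  unfold pdu
  split_ifs
  · exact pd_Dx_add_single _ _ _ _ _
  · rw [Dx_zero, add_zero]

theorem pdu_Dx_of_apply_eq_zero {j : Fin n} {K : Fin n →₀ ℕ} (hK : K j = 0) (k : Fin m) (s : ℕ)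
    (f : SmoothFn U) : pdu k s K (Dx j f) = Dx j (pdu k s K f) := by
  unfold pdu
  split_ifs
  · exact pd_Dx_of_apply_eq_zero hK _ _ _
  · rw [Dx_zero]

theorem pdu_DtBar (F : Fin m → SmoothFn U) (k : Fin m) (s : ℕ) (K : Fin n →₀ ℕ)
    (f : SmoothFn U) : pdu k s K (DtBar F f) =
      DtBar F (pdu k s K f) + vf (fun c => pdu k s K (dtBarCoeff F c)) f := by
  rw [DtBar_eq_vf]
  by_cases hs : s < h
  · simp only [pdu, dif_pos hs, pd_vf]
  · simp only [pdu, dif_neg hs, vf_zero, vf_zero_left, add_zero]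

theorem degree_add_single {ι : Type*} (I : ι →₀ ℕ) (j : ι) :
    (I + Finsupp.single j 1).degree = I.degree + 1 := by
  rw [map_add, Finsupp.degree_single]

/-- The coordinates `u^k_{s,I}` on which `f` depends have bidegrees `(|I|, s)` in `Z`. -/
def JetSupportIn (Z : ℕ → ℕ → Prop) (f : SmoothFn U) : Prop :=
  ∀ k s (K : Fin n →₀ ℕ), ¬ Z K.degree s → pdu k s K f = 0

theorem JetSupportIn.mono {Z Z' : ℕ → ℕ → Prop} {f : SmoothFn U} (hf : JetSupportIn Z f)
    (hZ : ∀ d s, s < h → Z d s → Z' d s) : JetSupportIn Z' f := by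
  intro k s K hK
  rcases lt_or_ge s h with hs | hs
  · exact hf k s K fun hZK => hK (hZ _ _ hs hZK)
  · exact pdu_of_le hs K f

theorem jetSupportIn_coordFn_u (k : Fin m) (s : Fin h) (I : Fin n →₀ ℕ) :
    JetSupportIn (fun d s' => d = I.degree ∧ s' = s) (coordFn (Coord.u k s I) : SmoothFn U) := by
  classical
  intro k' s' K hK
  rw [pdu_coordFn_u, if_neg]
  rintro ⟨-, rfl, rfl⟩
  exact hK ⟨rfl, rfl⟩

theorem JetSupportIn.apply_Dx {Z : ℕ → ℕ → Prop} {f : SmoothFn U} (hf : JetSupportIn Z f)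
    (j : Fin n) : JetSupportIn (fun d s => Z d s ∨ ∃ d', d = d' + 1 ∧ Z d' s) (Dx j f) := by
  intro k s K hK
  push Not at hK
  by_cases hj : K j = 0
  · rw [pdu_Dx_of_apply_eq_zero hj, hf k s K hK.1, Dx_zero]
  · obtain ⟨I, rfl⟩ := exists_eq_add_single hj
    rw [pdu_Dx_add_single, hf k s _ hK.1, hf k s I (hK.2 _ (degree_add_single I j)), Dx_zero,
      add_zero]

theorem JetSupportIn.apply_DxI {Z : ℕ → ℕ → Prop} {f : SmoothFn U} (hf : JetSupportIn Z f)
    (I : Fin n →₀ ℕ) :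
    JetSupportIn (fun d s => ∃ d' ≤ d, d ≤ d' + I.degree ∧ Z d' s) (DxI I f) := by
  induction I using multiIndex_induction with
  | zero =>
    rw [DxI_zero_index]
    exact hf.mono fun d s _ hZ => ⟨d, le_rfl, by omega, hZ⟩
  | add_single I j ih =>
    rw [DxI_add_single]
    refine (ih.apply_Dx j).mono ?_
    rintro d s - (⟨e, hed, hde, hZ⟩ | ⟨_, rfl, e, hed, hde, hZ⟩)
    all_goals exact ⟨e, by omega, by rw [degree_add_single]; omega, hZ⟩

/-- The space order of `f` is at most `a`. -/
def OrdLE (a : ℕ) (f : SmoothFn U) : Prop :=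
  ∀ k s (K : Fin n →₀ ℕ), a < K.degree → pdu k s K f = 0

/-- The space order of `f` is at most `a`, and the derivatives of space order `a` on which `f`
depends have time order at most `b`. -/
def LexLE (a b : ℕ) (f : SmoothFn U) : Prop :=
  ∀ k s (K : Fin n →₀ ℕ), (a < K.degree ∨ K.degree = a ∧ b < s) → pdu k s K f = 0

theorem ordLE_iff {a : ℕ} {f : SmoothFn U} : OrdLE a f ↔ JetSupportIn (fun d _ => d ≤ a) f := by
  simp only [OrdLE, JetSupportIn, not_le]

theorem LexLE.ordLE {a b : ℕ} {f : SmoothFn U} (hf : LexLE a b f) : OrdLE a f :=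
  fun k s K hK => hf k s K (Or.inl hK)

theorem OrdLE.apply_DxI {a : ℕ} {f : SmoothFn U} (hf : OrdLE a f) (I : Fin n →₀ ℕ) :
    OrdLE (a + I.degree) (DxI I f) :=
  ordLE_iff.2 <| ((ordLE_iff.1 hf).apply_DxI I).mono fun _ _ _ ⟨_, _, _, _⟩ => by omega

end JetSupport

section SymbolEntry

variable {n m h : ℕ} {U : TopologicalSpace.Opens (Coord n m (Fin h) → ℝ)}

theorem mem_finsuppAntidiag_univ {ι : Type*} [Fintype ι] [DecidableEq ι] {a : ℕ} {K : ι →₀ ℕ} :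
    K ∈ Finset.finsuppAntidiag Finset.univ a ↔ K.degree = a := by
  rw [Finset.mem_finsuppAntidiag', Finsupp.degree_eq_sum, Finsupp.sum_fintype _ _ fun _ => rfl]
  simp

/-- The form of degree `a` in the symbol variables with coefficients `∂f/∂u^j_{b,K}`, `|K| = a`:
an entry of `symbolAt a b`. -/
def symbolEntry (a b : ℕ) (j : Fin m) (f : SmoothFn U) : MvPolynomial (Fin n) (SmoothFn U) :=
  ∑ K ∈ Finset.finsuppAntidiag Finset.univ a, MvPolynomial.monomial K (pdu j b K f)

theorem symbolAt_apply {p : ℕ} (a b : ℕ) (f : Fin p → SmoothFn U) (i : Fin p) (j : Fin m) :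
    symbolAt a b f i j = symbolEntry a b j (f i) := rfl

theorem coeff_symbolEntry (a b : ℕ) (j : Fin m) (f : SmoothFn U) (K : Fin n →₀ ℕ) :
    MvPolynomial.coeff K (symbolEntry a b j f) = if K.degree = a then pdu j b K f else 0 := by
  classical
  rw [symbolEntry, MvPolynomial.coeff_sum]
  simp only [MvPolynomial.coeff_monomial, Finset.sum_ite_eq', mem_finsuppAntidiag_univ]

theorem symbolEntry_congr {a b b' : ℕ} {j : Fin m} {f g : SmoothFn U}
    (hfg : ∀ K : Fin n →₀ ℕ, K.degree = a → pdu j b K f = pdu j b' K g) :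
    symbolEntry a b j f = symbolEntry a b' j g :=
  Finset.sum_congr rfl fun K hK => by rw [hfg K (mem_finsuppAntidiag_univ.1 hK)]

theorem symbolEntry_Dx {a : ℕ} {f : SmoothFn U} (hf : OrdLE a f) (b : ℕ) (j : Fin m) (i : Fin n) :
    symbolEntry (a + 1) b j (Dx i f) = MvPolynomial.X i * symbolEntry a b j f := by
  classical
  ext1 K
  rw [MvPolynomial.coeff_X_mul', coeff_symbolEntry]
  by_cases hi : K i = 0
  · rw [if_neg (c := i ∈ K.support) (Finsupp.notMem_support_iff.2 hi)]
    split_ifs with hK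
    · rw [pdu_Dx_of_apply_eq_zero hi, hf j b K (by omega), Dx_zero]
    · rfl
  · obtain ⟨I, rfl⟩ := exists_eq_add_single hi
    rw [if_pos (c := i ∈ Finsupp.support _) (Finsupp.mem_support_iff.2 hi),
      add_tsub_cancel_right, coeff_symbolEntry, degree_add_single]
    simp only [add_left_inj]
    split_ifs with hK
    · rw [pdu_Dx_add_single, hf j b _ (by rw [degree_add_single]; omega), Dx_zero, zero_add]
    · rfl

theorem symbolEntry_DxI {a : ℕ} {f : SmoothFn U} (hf : OrdLE a f) (b : ℕ) (j : Fin m)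
    (I : Fin n →₀ ℕ) : symbolEntry (a + I.degree) b j (DxI I f) =
      MvPolynomial.monomial I 1 * symbolEntry a b j f := by
  induction I using multiIndex_induction with
  | zero => simp [DxI_zero_index]
  | add_single I i ih =>
    rw [DxI_add_single, degree_add_single, ← add_assoc, symbolEntry_Dx (hf.apply_DxI I), ih,
      ← mul_assoc, MvPolynomial.X, MvPolynomial.monomial_mul, one_mul, add_comm I]

end SymbolEntry

section TimeDerivatives

variable {n m h : ℕ} {U : TopologicalSpace.Opens (Coord n m (Fin h) → ℝ)}
  {F : Fin m → SmoothFn U} {N : ℕ}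

theorem dtBarCoeff_u_of_lt {s : Fin h} (hs : s.1 + 1 < h) (l : Fin m) (I : Fin n →₀ ℕ) :
    dtBarCoeff F (Coord.u l s I) = coordFn (Coord.u l ⟨s + 1, hs⟩ I) := by
  simp only [dtBarCoeff, dif_pos hs]

theorem dtBarCoeff_u_of_eq {s : Fin h} (hs : s.1 + 1 = h) (l : Fin m) (I : Fin n →₀ ℕ) :
    dtBarCoeff F (Coord.u l s I) = DxI I (F l) := by
  simp only [dtBarCoeff, dif_neg (show ¬ s.1 + 1 < h by omega)]

theorem vf_pdu_dtBarCoeff_eq_zero {f : SmoothFn U} {k : Fin m} {s : ℕ} {K : Fin n →₀ ℕ}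
    (hf : ∀ l (s' : Fin h) I, pdu l s' I f ≠ 0 → pdu k s K (dtBarCoeff F (Coord.u l s' I)) = 0) :
    vf (fun c => pdu k s K (dtBarCoeff F c)) f = 0 := by
  rw [vf_eq_sum _ f subset_rfl]
  refine Finset.sum_eq_zero fun c hc => ?_
  cases c with
  | t => simp only [dtBarCoeff, pdu_one, zero_mul]
  | x j => simp only [dtBarCoeff, pdu_zero, zero_mul]
  | u l s' I => rw [hf l s' I (by rw [pdu_val]; exact mem_supp.1 hc), zero_mul]

theorem jetSupportIn_DxI_rhs (hF : IsGenEvolution F) (hFN : ∀ l, OrdLE N (F l)) (l : Fin m)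
    (I : Fin n →₀ ℕ) :
    JetSupportIn (fun d s => d ≤ I.degree ∨ d ≤ I.degree + N ∧ s = 0) (DxI I (F l)) := by
  have hFl : JetSupportIn (fun d s => d = 0 ∨ d ≤ N ∧ s = 0) (F l) := by
    intro k s K hK
    simp only [Finsupp.degree_eq_zero_iff] at hK
    by_cases hs : s = 0
    · exact hFN l k s K (not_le.1 fun hle => hK (Or.inr ⟨hle, hs⟩))
    · exact hF l k s K hs fun hK0 => hK (Or.inl hK0)
  exact (hFl.apply_DxI I).mono fun _ _ _ ⟨_, _, _, _⟩ => by omega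

theorem JetSupportIn.apply_DtBar {Z Z' : ℕ → ℕ → Prop} {f : SmoothFn U} (hf : JetSupportIn Z f)
    (hF : IsGenEvolution F) (hFN : ∀ l, OrdLE N (F l))
    (hsub : ∀ d s, Z d s → Z' d s) (hshift : ∀ d s, Z d s → Z' d (s + 1))
    (hlow : ∀ d s, Z d s → s + 1 = h → ∀ d' ≤ d, ∀ s' < h, Z' d' s')
    (hhigh : ∀ d s, Z d s → s + 1 = h → ∀ d' ≤ d + N, Z' d' 0) :
    JetSupportIn Z' (DtBar F f) := by
  intro k s K hK
  rw [pdu_DtBar, hf k s K fun hZ => hK (hsub _ _ hZ), DtBar_eq_vf, vf_zero, zero_add]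
  refine vf_pdu_dtBarCoeff_eq_zero fun l s' I hne => ?_
  have hZ : Z I.degree s' := not_not.1 fun hZ => hne (hf l s' I hZ)
  refine JetSupportIn.mono (Z' := Z') ?_ (fun _ _ _ => id) k s K hK
  rcases Nat.lt_or_eq_of_le (Nat.succ_le_of_lt s'.2) with hs' | hs'
  · rw [dtBarCoeff_u_of_lt hs']
    refine (jetSupportIn_coordFn_u _ _ _).mono ?_
    rintro _ _ - ⟨rfl, rfl⟩
    exact hshift _ _ hZ
  · rw [dtBarCoeff_u_of_eq hs']
    refine (jetSupportIn_DxI_rhs hF hFN l I).mono ?_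
    rintro d e he (hd | ⟨hd, rfl⟩)
    · exact hlow _ _ hZ hs' d hd e he
    · exact hhigh _ _ hZ hs' d hd

-- The invariant: every time step moves `u_{s,I}` to `u_{s+1,I}`, and the steps past `u_{h-1,I}`
-- gain at most `N` space derivatives while restarting the time order at `0`.
theorem OrdLE.iterate_DtBar {a : ℕ} {f : SmoothFn U} (hf : OrdLE a f) (hF : IsGenEvolution F)
    (hFN : ∀ l, OrdLE N (F l)) {i : ℕ} (hi : i ≤ h) : OrdLE (a + N) ((DtBar F)^[i] f) := by
  have hinv : JetSupportIn (fun d s => d ≤ a ∨ d ≤ a + N ∧ s < i) ((DtBar F)^[i] f) := by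
    induction i with
    | zero => exact (ordLE_iff.1 hf).mono fun _ _ _ hd => Or.inl hd
    | succ i ih =>
      rw [Function.iterate_succ_apply']
      exact (ih (by omega)).apply_DtBar hF hFN (by omega) (by omega) (by omega) (by omega)
  exact ordLE_iff.2 <| hinv.mono fun _ _ _ _ => by omega

theorem LexLE.jetSupportIn_iterate_DtBar {a b : ℕ} (hb : b < h) {f : SmoothFn U}
    (hf : LexLE a b f) (hF : IsGenEvolution F) (hFN : ∀ l, OrdLE N (F l)) {i : ℕ} (hi : i ≤ h) :
    JetSupportIn (fun d s => d < a ∨ d = a ∧ s ≤ b + i ∨ d < a + N ∧ s < i ∨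
      d = a + N ∧ s + h ≤ b + i) ((DtBar F)^[i] f) := by
  induction i with
  | zero => exact fun k s K hK => hf k s K (by omega)
  | succ i ih =>
    rw [Function.iterate_succ_apply']
    exact (ih (by omega)).apply_DtBar hF hFN (by omega) (by omega) (by omega) (by omega)

theorem LexLE.pdu_iterate_DtBar_of_lt {a b : ℕ} (hb : b < h) {f : SmoothFn U} (hf : LexLE a b f)
    (hF : IsGenEvolution F) (hN : 0 < N) (hFN : ∀ l, OrdLE N (F l)) {i : ℕ} (hi : i < h)
    (k : Fin m) {K : Fin n →₀ ℕ} (hK : K.degree = a + N) : pdu k b K ((DtBar F)^[i] f) = 0 :=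
  hf.jetSupportIn_iterate_DtBar hb hF hFN hi.le k b K (by omega)

theorem pdu_succ_DtBar (hF : IsGenEvolution F) (hFN : ∀ l, OrdLE N (F l)) {f : SmoothFn U}
    {j : Fin m} {s : ℕ} {K : Fin n →₀ ℕ} (hs : s + 1 < h) (hsK : pdu j (s + 1) K f = 0)
    (htop : ∀ l (I : Fin n →₀ ℕ), K.degree ≤ I.degree → pdu l (h - 1) I f = 0) :
    pdu j (s + 1) K (DtBar F f) = pdu j s K f := by
  classical
  rw [pdu_DtBar, hsK, DtBar_eq_vf, vf_zero, zero_add, show pdu j s K f = pd (Coord.u j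
    ⟨s, by omega⟩ K) f from pdu_val j ⟨s, by omega⟩ K f, ← vf_indicator, vf_eq_sum _ f subset_rfl,
    vf_eq_sum _ f subset_rfl]
  refine Finset.sum_congr rfl fun c hc => ?_
  cases c with
  | t => simp [dtBarCoeff, pdu_one]
  | x l => simp [dtBarCoeff, pdu_zero]
  | u l s' I =>
    rcases Nat.lt_or_eq_of_le (Nat.succ_le_of_lt s'.2) with hs' | hs'
    · simp [dtBarCoeff_u_of_lt hs', pdu_coordFn_u, Fin.ext_iff]
    · have hI : I.degree < K.degree := by
        by_contra! hle
        refine mem_supp.1 hc ?_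
        rw [← pdu_val, show (s' : ℕ) = h - 1 by omega, htop l I hle]
      rw [dtBarCoeff_u_of_eq hs', jetSupportIn_DxI_rhs hF hFN l I j (s + 1) K (by omega), if_neg]
      simp only [Coord.u.injEq, Fin.ext_iff]
      omega

theorem pdu_zero_DtBar (hF : IsGenEvolution F) (hFN : ∀ l, OrdLE N (F l)) (hh : 0 < h)
    {f : SmoothFn U} {a : ℕ} {j : Fin m} {K : Fin n →₀ ℕ} (hK : K.degree = a + N)
    (hf : pdu j 0 K f = 0) (htop : ∀ l (I : Fin n →₀ ℕ), a < I.degree → pdu l (h - 1) I f = 0) :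
    pdu j 0 K (DtBar F f) = ∑ l, ∑ I ∈ Finset.finsuppAntidiag Finset.univ a,
      pdu l (h - 1) I f * pdu j 0 K (DxI I (F l)) := by
  classical
  have hlast : h - 1 < h := by omega
  let lastCoord : Fin m × (Fin n →₀ ℕ) → Coord n m (Fin h) :=
    fun q => Coord.u q.1 ⟨h - 1, hlast⟩ q.2
  have lastCoord_injective : lastCoord.Injective := fun ⟨l, I⟩ ⟨l', I'⟩ hq => by
    simpa [lastCoord] using hq
  rw [pdu_DtBar, hf, DtBar_eq_vf, vf_zero, zero_add, vf, finsum_eq_sum_of_support_subset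
    (s := (Finset.univ ×ˢ Finset.finsuppAntidiag Finset.univ a).image lastCoord),
    Finset.sum_image lastCoord_injective.injOn, Finset.sum_product]
  · refine Finset.sum_congr rfl fun l _ => Finset.sum_congr rfl fun I _ => ?_
    rw [dtBarCoeff_u_of_eq (by simp only; omega), ← pdu_val, mul_comm]
  · intro c hc
    obtain ⟨hwc, hfc⟩ := ne_zero_and_ne_zero_of_mul hc
    cases c with
    | t => exact absurd (pdu_one j 0 K) hwc
    | x q => exact absurd (pdu_zero j 0 K) hwc
    | u l s I =>
      rcases Nat.lt_or_eq_of_le (Nat.succ_le_of_lt s.2) with hs | hs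
      · rw [dtBarCoeff_u_of_lt hs, pdu_coordFn_u, if_neg (by simp)] at hwc
        exact absurd rfl hwc
      · obtain rfl : s = ⟨h - 1, hlast⟩ := Fin.ext (by simp only; omega)
        have hIa : I.degree ≤ a := not_lt.1 fun hlt => hfc (by rw [← pdu_val, htop l I hlt])
        have hKI : ¬ I.degree + N < K.degree := fun hlt => hwc <| by
          rw [dtBarCoeff_u_of_eq hs]
          exact jetSupportIn_DxI_rhs hF hFN l I j 0 K (by omega)
        refine Finset.mem_coe.2 (Finset.mem_image.2 ⟨(l, I), ?_, rfl⟩)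
        simp only [Finset.mem_product, Finset.mem_univ, mem_finsuppAntidiag_univ, true_and]
        omega

theorem symbolEntry_DtBar_zero (hF : IsGenEvolution F) (hFN : ∀ l, OrdLE N (F l)) (hh : 0 < h)
    {f : SmoothFn U} {a : ℕ} {j : Fin m}
    (hf : ∀ K : Fin n →₀ ℕ, K.degree = a + N → pdu j 0 K f = 0)
    (htop : ∀ l (I : Fin n →₀ ℕ), a < I.degree → pdu l (h - 1) I f = 0) :
    symbolEntry (a + N) 0 j (DtBar F f) =
      ∑ l, symbolEntry a (h - 1) l f * symbolEntry N 0 j (F l) := by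
  have hexpand : symbolEntry (a + N) 0 j (DtBar F f) =
      ∑ l, ∑ I ∈ Finset.finsuppAntidiag Finset.univ a,
        MvPolynomial.C (pdu l (h - 1) I f) * symbolEntry (a + N) 0 j (DxI I (F l)) := by
    ext1 K
    simp only [MvPolynomial.coeff_sum, MvPolynomial.coeff_C_mul, coeff_symbolEntry]
    split_ifs with hK
    · exact pdu_zero_DtBar hF hFN hh hK (hf K hK) htop
    · simp only [mul_zero, Finset.sum_const_zero]
  rw [hexpand]
  refine Finset.sum_congr rfl fun l _ => ?_
  rw [symbolEntry, Finset.sum_mul]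
  refine Finset.sum_congr rfl fun I hI => ?_
  rw [← mem_finsuppAntidiag_univ.1 hI, add_comm, symbolEntry_DxI (hFN l), ← mul_assoc,
    MvPolynomial.C_mul_monomial, mul_one]

theorem LexLE.pdu_iterate_DtBar_shift {a b : ℕ} {f : SmoothFn U} (hf : LexLE a b f)
    (hF : IsGenEvolution F) (hFN : ∀ l, OrdLE N (F l)) {i : ℕ} (hi : b + i < h)
    (j : Fin m) {K : Fin n →₀ ℕ} (hK : K.degree = a) :
    pdu j (b + i) K ((DtBar F)^[i] f) = pdu j b K f := by
  induction i with
  | zero => rfl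
  | succ i ih =>
    have hsupp := hf.jetSupportIn_iterate_DtBar (i := i) (by omega) hF hFN (by omega)
    rw [Function.iterate_succ_apply', ← add_assoc, pdu_succ_DtBar hF hFN (by omega)
      (hsupp j _ K (by omega)) fun l I hI => hsupp l _ I (by omega), ih (by omega)]

theorem LexLE.pdu_iterate_DtBar_shift_top {a b : ℕ} (hb : b < h) {f : SmoothFn U}
    (hf : LexLE a b f) (hF : IsGenEvolution F) (hN : 0 < N) (hFN : ∀ l, OrdLE N (F l)) {r : ℕ}
    (hr : r ≤ b) (j : Fin m) {K : Fin n →₀ ℕ} (hK : K.degree = a + N) :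
    pdu j r K ((DtBar F)^[h - b + r] f) = pdu j 0 K ((DtBar F)^[h - b] f) := by
  induction r with
  | zero => rfl
  | succ r ih =>
    have hsupp := hf.jetSupportIn_iterate_DtBar (i := h - b + r) hb hF hFN (by omega)
    rw [← add_assoc, Function.iterate_succ_apply', pdu_succ_DtBar hF hFN (by omega)
      (hsupp j _ K (by omega)) fun l I hI => hsupp l _ I (by omega), ih (by omega)]

-- Of the `h` time steps, the first `h - 1 - b` raise the top time order of `f` from `b` to `h - 1`,
-- the next one trades `u_{h-1,I}` for `D_x^I F`, and the last `b` raise the time order back to `b`.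
theorem LexLE.symbolEntry_iterate_DtBar {a b : ℕ} (hb : b < h) {f : SmoothFn U}
    (hf : LexLE a b f) (hF : IsGenEvolution F) (hN : 0 < N) (hFN : ∀ l, OrdLE N (F l))
    (j : Fin m) : symbolEntry (a + N) b j ((DtBar F)^[h] f) =
      ∑ l, symbolEntry a b l f * symbolEntry N 0 j (F l) := by
  obtain ⟨i, rfl⟩ : ∃ i, h = b + i + 1 := ⟨h - b - 1, by omega⟩
  have hsupp := hf.jetSupportIn_iterate_DtBar (i := i) hb hF hFN (by omega)
  have hlast : symbolEntry (a + N) b j ((DtBar F)^[b + i + 1] f) =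
      symbolEntry (a + N) 0 j (DtBar F ((DtBar F)^[i] f)) :=
    symbolEntry_congr fun K hK => by
      have hshift := hf.pdu_iterate_DtBar_shift_top hb hF hN hFN le_rfl j hK
      rwa [show b + i + 1 - b = i + 1 by omega, show i + 1 + b = b + i + 1 by omega,
        Function.iterate_succ_apply' _ i] at hshift
  have hfirst (l : Fin m) : symbolEntry a (b + i) l ((DtBar F)^[i] f) = symbolEntry a b l f :=
    symbolEntry_congr fun K hK => hf.pdu_iterate_DtBar_shift hF hFN (by omega) l hK
  rw [hlast, symbolEntry_DtBar_zero hF hFN (by omega) (fun K hK => hsupp j 0 K (by omega))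
    fun l I hI => hsupp l _ I (by omega)]
  simp only [Nat.add_sub_cancel, hfirst]

end TimeDerivatives

/-! ### Normal forms of the adjoint operator -/

section Leibniz

theorem iterate_derivation_mul {R A : Type*} [CommSemiring R] [CommSemiring A] [Algebra R A]
    (D : Derivation R A A) (i : ℕ) (x y : A) :
    D^[i] (x * y) = ∑ j ∈ Finset.range (i + 1), i.choose j * D^[i - j] x * D^[j] y := by
  have hanti : D^[i] (y * x) =
      ∑ ij ∈ Finset.HasAntidiagonal.antidiagonal i, i.choose ij.1 • (D^[ij.1] y * D^[ij.2] x) := by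
    induction i with
    | zero => simp
    | succ i ih =>
      rw [Finset.sum_antidiagonal_choose_succ_nsmul (fun p q => D^[p] y * D^[q] x) i]
      simp only [Function.iterate_succ_apply', ih, map_sum, map_nsmul, Derivation.leibniz,
        smul_add, Finset.sum_add_distrib, smul_eq_mul]
      congr 1
      refine Finset.sum_congr rfl fun ⟨p, q⟩ hpq => ?_
      rw [i.choose_symm_of_eq_add (Finset.HasAntidiagonal.mem_antidiagonal.1 hpq).symm, mul_comm]
  rw [mul_comm, hanti, Finset.Nat.sum_antidiagonal_eq_sum_range_succ
    (fun p q => i.choose p • (D^[p] y * D^[q] x))]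
  exact Finset.sum_congr rfl fun j _ => by rw [nsmul_eq_mul, mul_comm (D^[j] y), mul_assoc]

theorem prod_choose_eq_zero {ι : Type*} [Fintype ι] {I J : ι →₀ ℕ} (hJI : ¬ J ≤ I) :
    ∏ i, (I i).choose (J i) = 0 := by
  obtain ⟨i, hi⟩ : ∃ i, ¬ J i ≤ I i := by simpa [Finsupp.le_def] using hJI
  exact Finset.prod_eq_zero (Finset.mem_univ i) (Nat.choose_eq_zero_of_lt (not_le.1 hi))

theorem prod_choose_add_single_of_apply_eq_zero {ι : Type*} [Fintype ι] (I : ι →₀ ℕ)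
    {J : ι →₀ ℕ} {j : ι} (hJ : J j = 0) :
    ∏ i, ((I + Finsupp.single j 1 : ι →₀ ℕ) i).choose (J i) = ∏ i, (I i).choose (J i) := by
  refine Finset.prod_congr rfl fun i _ => ?_
  rcases eq_or_ne i j with rfl | hij
  · rw [hJ, Nat.choose_zero_right, Nat.choose_zero_right]
  · rw [Finsupp.add_apply, Finsupp.single_eq_of_ne hij, add_zero]

theorem prod_choose_add_single_add_single {ι : Type*} [Fintype ι] (I J : ι →₀ ℕ) (j : ι) :
    ∏ i, ((I + Finsupp.single j 1 : ι →₀ ℕ) i).choose ((J + Finsupp.single j 1 : ι →₀ ℕ) i) =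
      ∏ i, (I i).choose ((J + Finsupp.single j 1 : ι →₀ ℕ) i) + ∏ i, (I i).choose (J i) := by
  classical
  have herase (I' J' : ι →₀ ℕ) (hI : ∀ i ≠ j, I' i = I i) (hJ : ∀ i ≠ j, J' i = J i) :
      ∏ i ∈ Finset.univ.erase j, (I' i).choose (J' i) =
        ∏ i ∈ Finset.univ.erase j, (I i).choose (J i) :=
    Finset.prod_congr rfl fun i hi => by
      rw [hI i (Finset.ne_of_mem_erase hi), hJ i (Finset.ne_of_mem_erase hi)]
  have hsingle (K : ι →₀ ℕ) (i : ι) (hij : i ≠ j) :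
      (K + Finsupp.single j 1 : ι →₀ ℕ) i = K i := by
    rw [Finsupp.add_apply, Finsupp.single_eq_of_ne hij, add_zero]
  simp only [← Finset.mul_prod_erase Finset.univ _ (Finset.mem_univ j)]
  rw [herase _ _ (hsingle I) (hsingle J), herase _ _ (fun _ _ => rfl) (hsingle J)]
  simp only [Finsupp.add_apply, Finsupp.single_eq_same, Nat.choose_succ_succ']
  ring

variable {n m : ℕ} {σ : Type} {U : TopologicalSpace.Opens (Coord n m σ → ℝ)}

/-- The coefficients of the operator `ψ ↦ D_x^I (f ψ)` with respect to the operators `D_x^J`. -/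
def leibnizCoeffs (f : SmoothFn U) (I : Fin n →₀ ℕ) : (Fin n →₀ ℕ) →₀ SmoothFn U :=
  Finsupp.onFinset (Finset.Iic I) (fun J => (∏ i, (I i).choose (J i) : ℕ) * DxI (I - J) f)
    fun J hJ => by
      by_contra hJI
      rw [Finset.mem_Iic] at hJI
      rw [prod_choose_eq_zero hJI, Nat.cast_zero, zero_mul] at hJ
      exact hJ rfl

theorem leibnizCoeffs_apply (f : SmoothFn U) (I J : Fin n →₀ ℕ) :
    leibnizCoeffs f I J = (∏ i, (I i).choose (J i) : ℕ) * DxI (I - J) f := rfl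

theorem leibnizCoeffs_self (f : SmoothFn U) (I : Fin n →₀ ℕ) : leibnizCoeffs f I I = f := by
  simp [leibnizCoeffs_apply, DxI_zero_index]

theorem leibnizCoeffs_eq_zero (f : SmoothFn U) {I J : Fin n →₀ ℕ} (hJI : ¬ J ≤ I) :
    leibnizCoeffs f I J = 0 := by
  rw [leibnizCoeffs_apply, prod_choose_eq_zero hJI, Nat.cast_zero, zero_mul]

theorem Dx_leibnizCoeffs (f : SmoothFn U) (I J : Fin n →₀ ℕ) (j : Fin n) :
    Dx j (leibnizCoeffs f I J) =
      (∏ i, (I i).choose (J i) : ℕ) * DxI (I + Finsupp.single j 1 - J) f := by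
  rw [leibnizCoeffs_apply, ← coe_dxDerivation, ← nsmul_eq_mul, map_nsmul, nsmul_eq_mul,
    coe_dxDerivation, ← DxI_add_single]
  by_cases hJI : J ≤ I
  · rw [tsub_add_eq_add_tsub hJI]
  · rw [prod_choose_eq_zero hJI, Nat.cast_zero, zero_mul, zero_mul]

theorem leibnizCoeffs_add_single (f : SmoothFn U) (I : Fin n →₀ ℕ) (j : Fin n) :
    leibnizCoeffs f (I + Finsupp.single j 1) =
      (leibnizCoeffs f I).mapRange (Dx j) (Dx_zero j) +
        (leibnizCoeffs f I).mapDomain (· + Finsupp.single j 1) := by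
  ext1 J
  rw [Finsupp.add_apply, Finsupp.mapRange_apply, Dx_leibnizCoeffs]
  by_cases hj : J j = 0
  · rw [Finsupp.mapDomain_of_notMem_range, add_zero, leibnizCoeffs_apply,
      prod_choose_add_single_of_apply_eq_zero I hj]
    rintro ⟨J, rfl⟩
    simp at hj
  · obtain ⟨J, rfl⟩ := exists_eq_add_single hj
    rw [Finsupp.mapDomain_apply (add_left_injective (Finsupp.single j 1)), leibnizCoeffs_apply,
      leibnizCoeffs_apply, prod_choose_add_single_add_single, add_tsub_add_eq_tsub_right,
      Nat.cast_add, add_mul]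

theorem DxI_mul (f ψ : SmoothFn U) (I : Fin n →₀ ℕ) :
    DxI I (f * ψ) = (leibnizCoeffs f I).sum fun J c => c * DxI J ψ := by
  induction I using multiIndex_induction with
  | zero =>
    rw [show leibnizCoeffs f 0 = Finsupp.single 0 f from ?_,
      Finsupp.sum_single_index (zero_mul _), DxI_zero_index, DxI_zero_index]
    ext1 J
    rcases eq_or_ne J 0 with rfl | hJ
    · rw [leibnizCoeffs_self, Finsupp.single_eq_same]
    · rw [leibnizCoeffs_eq_zero f (by simpa using hJ), Finsupp.single_eq_of_ne hJ]
  | add_single I j ih =>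
    rw [DxI_add_single, ih, leibnizCoeffs_add_single, Finsupp.sum_add_index'
      (fun _ => zero_mul _) (fun _ _ _ => add_mul _ _ _), Finsupp.sum_mapRange_index
      (fun _ => zero_mul _), Finsupp.sum_mapDomain_index (fun _ => zero_mul _)
      (fun _ _ _ => add_mul _ _ _), Finsupp.sum, Finsupp.sum, Finsupp.sum, ← coe_dxDerivation,
      map_sum, ← Finset.sum_add_distrib]
    refine Finset.sum_congr rfl fun J _ => ?_
    rw [coe_dxDerivation, Dx_mul, DxI_add_single]
    ring

end Leibniz

section OrderClosure

variable {n m h : ℕ} {U : TopologicalSpace.Opens (Coord n m (Fin h) → ℝ)}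

theorem OrdLE.mono {a b : ℕ} {f : SmoothFn U} (hf : OrdLE a f) (hab : a ≤ b) : OrdLE b f :=
  fun k s K hK => hf k s K (by omega)

theorem ordLE_zero (a : ℕ) : OrdLE a (0 : SmoothFn U) := fun k s K _ => pdu_zero k s K

theorem OrdLE.add {a : ℕ} {f g : SmoothFn U} (hf : OrdLE a f) (hg : OrdLE a g) :
    OrdLE a (f + g) := fun k s K hK => by
  rw [← coe_pduDerivation, map_add, coe_pduDerivation, hf k s K hK, hg k s K hK, add_zero]

theorem OrdLE.mul {a : ℕ} {f g : SmoothFn U} (hf : OrdLE a f) (hg : OrdLE a g) :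
    OrdLE a (f * g) := fun k s K hK => by
  rw [pdu_mul, hf k s K hK, hg k s K hK, mul_zero, mul_zero, add_zero]

theorem ordLE_sum {α : Type*} {a : ℕ} {S : Finset α} {f : α → SmoothFn U}
    (hf : ∀ i ∈ S, OrdLE a (f i)) : OrdLE a (∑ i ∈ S, f i) := fun k s K hK => by
  rw [pdu_sum]
  exact Finset.sum_eq_zero fun i hi => hf i hi k s K hK

theorem ordLE_intCast (a : ℕ) (q : ℤ) : OrdLE a (q : SmoothFn U) := fun k s K _ => by
  rw [← coe_pduDerivation, Derivation.map_intCast]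

theorem ordLE_neg_one_pow (a q : ℕ) : OrdLE a ((-1) ^ q : SmoothFn U) := by
  simpa using ordLE_intCast (U := U) a ((-1) ^ q)

theorem ordLE_natCast (a q : ℕ) : OrdLE a (q : SmoothFn U) := by
  simpa using ordLE_intCast (U := U) a q

theorem OrdLE.apply_pdu {a : ℕ} {f : SmoothFn U} (hf : OrdLE a f) (k : Fin m) (s : ℕ)
    (K : Fin n →₀ ℕ) : OrdLE a (pdu k s K f) := fun k' s' K' hK' => by
  rw [pdu_comm, hf k' s' K' hK', pdu_zero]

theorem OrdLE.leibnizCoeffs {a : ℕ} {f : SmoothFn U} (hf : OrdLE a f) (I J : Fin n →₀ ℕ) :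
    OrdLE (a + I.degree) (leibnizCoeffs f I J) := by
  rw [leibnizCoeffs_apply]
  refine (ordLE_natCast _ _).mul ((hf.apply_DxI (I - J)).mono ?_)
  gcongr
  exact Finsupp.degree_mono tsub_le_self

end OrderClosure

section Existence

variable {n m h : ℕ} {U : TopologicalSpace.Opens (Coord n m (Fin h) → ℝ)}
  {F : Fin m → SmoothFn U} {N : ℕ}

/-- The multi-indices of degree at most `N`. -/
def multiIndicesLE (n N : ℕ) : Finset (Fin n →₀ ℕ) :=
  (Finset.range (N + 1)).biUnion fun a => Finset.finsuppAntidiag Finset.univ a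

theorem mem_multiIndicesLE {N : ℕ} {I : Fin n →₀ ℕ} : I ∈ multiIndicesLE n N ↔ I.degree ≤ N := by
  simp only [multiIndicesLE, Finset.mem_biUnion, mem_finsuppAntidiag_univ, Finset.mem_range]
  constructor
  · rintro ⟨_, ha, rfl⟩
    omega
  · exact fun hI => ⟨_, by omega, rfl⟩

theorem finsum_eq_sum_multiIndicesLE {M : Type*} [AddCommMonoid M] {c : (Fin n →₀ ℕ) → M}
    (hc : ∀ I, N < I.degree → c I = 0) : ∑ᶠ I, c I = ∑ I ∈ multiIndicesLE n N, c I :=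
  finsum_eq_sum_of_support_subset _ fun I hI => by
    rw [Finset.mem_coe, mem_multiIndicesLE]
    by_contra hlt
    exact hI (hc I (by omega))

theorem sum_DxI_mul (c : (Fin n →₀ ℕ) → SmoothFn U) (ψ : SmoothFn U) :
    ∑ I ∈ multiIndicesLE n N, (-1) ^ I.degree * DxI I (c I * ψ) =
      ∑ J ∈ multiIndicesLE n N, (∑ I ∈ multiIndicesLE n N,
        (-1) ^ I.degree * leibnizCoeffs (c I) I J) * DxI J ψ := by
  simp only [Finset.sum_mul]
  rw [Finset.sum_comm]
  refine Finset.sum_congr rfl fun I hI => ?_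
  have hsupp : (leibnizCoeffs (c I) I).support ⊆ multiIndicesLE n N := fun J hJ => by
    have hJI : J ≤ I := not_not.1 fun hJI =>
      Finsupp.mem_support_iff.1 hJ (leibnizCoeffs_eq_zero _ hJI)
    exact mem_multiIndicesLE.2 ((Finsupp.degree_mono hJI).trans (mem_multiIndicesLE.1 hI))
  rw [DxI_mul, Finsupp.sum_of_support_subset _ hsupp (fun J c => c * DxI J ψ)
    fun _ _ => zero_mul _, Finset.mul_sum]
  exact Finset.sum_congr rfl fun J _ => by rw [mul_assoc]

theorem sum_Ico_iterate_DtBar_mul (F : Fin m → SmoothFn U) (c : ℕ → SmoothFn U) (ψ : SmoothFn U) :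
    ∑ s ∈ Finset.Ico 1 h, (-1) ^ s * (DtBar F)^[s] (c s * ψ) =
      (∑ s ∈ Finset.Ico 1 h, (-1) ^ s * (DtBar F)^[s] (c s)) * ψ +
        ∑ r ∈ Finset.Ico 1 h, (∑ s ∈ Finset.Ico 1 h,
          (-1) ^ s * (s.choose r * (DtBar F)^[s - r] (c s))) * (DtBar F)^[r] ψ := by
  simp only [Finset.sum_mul]
  rw [Finset.sum_comm, ← Finset.sum_add_distrib]
  refine Finset.sum_congr rfl fun s hs => ?_
  rw [Finset.mem_Ico] at hs
  have hrange : ∑ r ∈ Finset.range (s + 1),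
        s.choose r * (DtBar F)^[s - r] (c s) * (DtBar F)^[r] ψ =
      ∑ r ∈ Finset.range h, s.choose r * (DtBar F)^[s - r] (c s) * (DtBar F)^[r] ψ := by
    refine Finset.sum_subset (Finset.range_subset_range.2 (by omega)) fun r _ hr => ?_
    rw [Finset.mem_range] at hr
    rw [Nat.choose_eq_zero_of_lt (by omega), Nat.cast_zero, zero_mul, zero_mul]
  have hleibniz := iterate_derivation_mul (dtBarDerivation F) s (c s) ψ
  rw [coe_dtBarDerivation] at hleibniz
  rw [hleibniz, hrange, Finset.range_eq_Ico, Finset.sum_eq_sum_Ico_succ_bot (by omega),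
    mul_add, Finset.mul_sum]
  congr 1
  · simp [mul_assoc]
  · exact Finset.sum_congr rfl fun r _ => by ring

variable (F N) in
/-- The coefficients that the Leibniz rule gives for the operators `adjL F i j`; the time
derivatives contribute to the coefficient of the identity as well. -/
def normalFormCoeffs : OpCoeffs U where
  f i j J := ∑ I ∈ multiIndicesLE n N, (-1) ^ I.degree * leibnizCoeffs (pdu i 0 I (F j)) I J +
    if J = 0 then ∑ s ∈ Finset.Ico 1 h, (-1) ^ s * (DtBar F)^[s] (pdu i s 0 (F j)) else 0
  g i j r := if r ∈ Finset.Ico 1 h then ∑ s ∈ Finset.Ico 1 h,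
    (-1) ^ s * (s.choose r * (DtBar F)^[s - r] (pdu i s 0 (F j))) else 0

theorem normalFormCoeffs_f_of_ne_zero (F : Fin m → SmoothFn U) (N : ℕ) (i j : Fin m)
    {J : Fin n →₀ ℕ} (hJ : J ≠ 0) : (normalFormCoeffs F N).f i j J =
      ∑ I ∈ multiIndicesLE n N, (-1) ^ I.degree * leibnizCoeffs (pdu i 0 I (F j)) I J := by
  simp only [normalFormCoeffs, if_neg hJ, add_zero]

theorem normalFormCoeffs_f_of_lt (F : Fin m → SmoothFn U) (i j : Fin m) {J : Fin n →₀ ℕ}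
    (hJ : N < J.degree) : (normalFormCoeffs F N).f i j J = 0 := by
  rw [normalFormCoeffs_f_of_ne_zero F N i j fun hJ0 => by simp [hJ0] at hJ]
  refine Finset.sum_eq_zero fun I hI => ?_
  rw [mem_multiIndicesLE] at hI
  rw [leibnizCoeffs_eq_zero _ fun hJI => by have := Finsupp.degree_mono hJI; omega, mul_zero]

theorem normalFormCoeffs_f_of_degree_eq (F : Fin m → SmoothFn U) (hN : 0 < N) (i j : Fin m)
    {J : Fin n →₀ ℕ} (hJ : J.degree = N) :
    (normalFormCoeffs F N).f i j J = (-1) ^ N * pdu i 0 J (F j) := by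
  rw [normalFormCoeffs_f_of_ne_zero F N i j fun hJ0 => by simp [hJ0] at hJ; omega,
    Finset.sum_eq_single_of_mem J (mem_multiIndicesLE.2 hJ.le) fun I hI hne => ?_,
    leibnizCoeffs_self, hJ]
  rw [leibnizCoeffs_eq_zero _ fun hJI => hne ?_, mul_zero]
  rw [mem_multiIndicesLE] at hI
  obtain ⟨K, rfl⟩ := exists_add_of_le hJI
  rw [map_add] at hI
  rw [(Finsupp.degree_eq_zero_iff K).1 (by omega), add_zero]

theorem isNormalForm_normalFormCoeffs (hFN : ∀ l, OrdLE N (F l)) :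
    IsNormalForm F N (normalFormCoeffs F N) := by
  refine ⟨fun i j J hJ => normalFormCoeffs_f_of_lt F i j hJ, fun i j s hs => if_neg hs,
    fun i j ψ => ?_⟩
  rw [adjL, finsum_eq_sum_multiIndicesLE (N := N) fun I hI => by
      rw [hFN j i 0 I hI, zero_mul, DxI_zero, mul_zero],
    finsum_eq_sum_multiIndicesLE (N := N) fun I hI => by
      rw [normalFormCoeffs_f_of_lt F i j hI, zero_mul],
    sum_DxI_mul, sum_Ico_iterate_DtBar_mul, ← add_assoc]
  congr 1
  · simp only [normalFormCoeffs, add_mul, Finset.sum_add_distrib, ite_mul, zero_mul]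
    rw [Finset.sum_ite_eq', if_pos (by simp [mem_multiIndicesLE]), DxI_zero_index]
  · exact Finset.sum_congr rfl fun r hr => by simp only [normalFormCoeffs, if_pos hr]

theorem ordLE_normalFormCoeffs_f (hF : IsGenEvolution F) (hFN : ∀ l, OrdLE N (F l)) (i j : Fin m)
    (J : Fin n →₀ ℕ) : OrdLE (N + N) ((normalFormCoeffs F N).f i j J) := by
  refine OrdLE.add (ordLE_sum fun I hI => (ordLE_neg_one_pow _ _).mul
    ((((hFN j).apply_pdu i 0 I).leibnizCoeffs I J).mono ?_)) ?_
  · rw [mem_multiIndicesLE] at hI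
    omega
  · split_ifs
    · exact ordLE_sum fun s hs => (ordLE_neg_one_pow _ _).mul
        (((hFN j).apply_pdu i s 0).iterate_DtBar hF hFN (Finset.mem_Ico.1 hs).2.le)
    · exact ordLE_zero _

theorem ordLE_normalFormCoeffs_g (hF : IsGenEvolution F) (hFN : ∀ l, OrdLE N (F l)) (i j : Fin m)
    (r : ℕ) : OrdLE (N + N) ((normalFormCoeffs F N).g i j r) := by
  simp only [normalFormCoeffs]
  split_ifs
  · refine ordLE_sum fun s hs => (ordLE_neg_one_pow _ _).mul ((ordLE_natCast _ _).mul
      (((hFN j).apply_pdu i s 0).iterate_DtBar hF hFN ?_))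
    rw [Finset.mem_Ico] at hs
    omega
  · exact ordLE_zero _

end Existence

section Uniqueness

variable {n m h : ℕ} {U : TopologicalSpace.Opens (Coord n m (Fin h) → ℝ)}

/-- Polynomials in the space variables as functions on the jet space: the test functions that
determine the coefficients of the space derivatives. -/
def xPoly : MvPolynomial (Fin n) ℝ →ₐ[ℝ] SmoothFn U :=
  MvPolynomial.aeval fun j => coordFn (Coord.x j)

theorem Dx_xPoly (j : Fin n) (p : MvPolynomial (Fin n) ℝ) :
    Dx j (xPoly p : SmoothFn U) = xPoly (MvPolynomial.pderiv j p) := by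
  classical
  induction p using MvPolynomial.induction_on with
  | C a =>
    rw [MvPolynomial.pderiv_C, map_zero, ← coe_dxDerivation, xPoly, MvPolynomial.aeval_C,
      Derivation.map_algebraMap]
  | add p q hp hq => rw [map_add, Dx_add, hp, hq, map_add, map_add]
  | mul_X p i hp =>
    rw [map_mul, Dx_mul, hp, Derivation.leibniz, map_add, smul_eq_mul, smul_eq_mul, map_mul,
      map_mul, MvPolynomial.pderiv_X]
    congr 2
    simp only [xPoly, MvPolynomial.aeval_X, Dx_coordFn, dxCoeff, Pi.single_apply]
    split_ifs <;> simp

theorem DtBar_xPoly (F : Fin m → SmoothFn U) (p : MvPolynomial (Fin n) ℝ) :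
    DtBar F (xPoly p) = 0 := by
  rw [← coe_dtBarDerivation]
  induction p using MvPolynomial.induction_on with
  | C a => rw [xPoly, MvPolynomial.aeval_C, Derivation.map_algebraMap]
  | add p q hp hq => rw [map_add, map_add, hp, hq, add_zero]
  | mul_X p i hp =>
    rw [map_mul, Derivation.leibniz, hp, smul_zero, add_zero, coe_dtBarDerivation, xPoly,
      MvPolynomial.aeval_X, DtBar_coordFn, dtBarCoeff, smul_zero]

theorem DxI_xPoly_monomial (I J : Fin n →₀ ℕ) :
    DxI I (xPoly (MvPolynomial.monomial J 1) : SmoothFn U) =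
      xPoly (MvPolynomial.monomial (J - I) (∏ i, (J i).descFactorial (I i) : ℕ)) := by
  classical
  induction I using multiIndex_induction with
  | zero => simp [DxI_zero_index]
  | add_single I j ih =>
    rw [DxI_add_single, ih, Dx_xPoly, MvPolynomial.pderiv_monomial, tsub_tsub, ← Nat.cast_mul]
    congr 3
    rw [← Finset.mul_prod_erase Finset.univ _ (Finset.mem_univ j),
      ← Finset.mul_prod_erase Finset.univ _ (Finset.mem_univ j),
      Finset.prod_congr rfl fun i hi => show (J i).descFactorial (I i) =
        (J i).descFactorial ((I + Finsupp.single j 1 : Fin n →₀ ℕ) i) by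
          rw [Finsupp.add_apply, Finsupp.single_eq_of_ne (Finset.ne_of_mem_erase hi), add_zero],
      Finsupp.add_apply, Finsupp.single_eq_same, Nat.descFactorial_succ, Finsupp.tsub_apply]
    ring

theorem iterate_DtBar_t_pow (F : Fin m → SmoothFn U) (r s : ℕ) :
    (DtBar F)^[s] (coordFn Coord.t ^ r) =
      (r.descFactorial s : SmoothFn U) * coordFn Coord.t ^ (r - s) := by
  induction s with
  | zero => simp
  | succ s ih =>
    rw [Function.iterate_succ_apply', ih, ← coe_dtBarDerivation, ← nsmul_eq_mul, map_nsmul,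
      Derivation.leibniz_pow, coe_dtBarDerivation, DtBar_coordFn, dtBarCoeff,
      Nat.descFactorial_succ, nsmul_eq_mul, nsmul_eq_mul, smul_eq_mul, mul_one, Nat.cast_mul,
      Nat.sub_sub]
    ring

theorem eq_zero_of_mul_natCast_eq_zero {f : SmoothFn U} {c : ℕ} (hc : c ≠ 0)
    (hf : f * (c : SmoothFn U) = 0) : f = 0 := by
  rw [mul_comm, ← nsmul_eq_mul, ← Nat.cast_smul_eq_nsmul ℝ] at hf
  exact (smul_eq_zero_iff_right (Nat.cast_ne_zero.2 hc)).1 hf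

theorem space_coeffs_eq_zero (F : Fin m → SmoothFn U) {S : Finset (Fin n →₀ ℕ)} {T : Finset ℕ}
    (hT : 0 ∉ T) {f : (Fin n →₀ ℕ) → SmoothFn U} {g : ℕ → SmoothFn U}
    (hfg : ∀ ψ, ∑ I ∈ S, f I * DxI I ψ + ∑ s ∈ T, g s * (DtBar F)^[s] ψ = 0) :
    ∀ J ∈ S, f J = 0 := by
  intro J
  induction J using WellFoundedLT.induction with
  | ind J ih =>
    intro hJ
    have htime : ∑ s ∈ T, g s * (DtBar F)^[s] (xPoly (MvPolynomial.monomial J 1)) = 0 := by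
      refine Finset.sum_eq_zero fun s hs => ?_
      obtain ⟨r, rfl⟩ := Nat.exists_eq_succ_of_ne_zero (ne_of_mem_of_not_mem hs hT)
      rw [Function.iterate_succ_apply, DtBar_xPoly, ← coe_dtBarDerivation, iterate_map_zero,
        mul_zero]
    have heval := hfg (xPoly (MvPolynomial.monomial J 1))
    rw [htime, add_zero, Finset.sum_eq_single_of_mem J hJ fun I hI hne => ?_, DxI_xPoly_monomial,
      tsub_self, xPoly, MvPolynomial.aeval_monomial, Finsupp.prod_zero_index, mul_one,
      map_natCast] at heval
    · exact eq_zero_of_mul_natCast_eq_zero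
        (Finset.prod_ne_zero_iff.2 fun i _ => by simp [Nat.descFactorial_self,
          Nat.factorial_ne_zero]) heval
    · by_cases hIJ : I ≤ J
      · rw [ih I (lt_of_le_of_ne hIJ hne) hI, zero_mul]
      · obtain ⟨i, hi⟩ : ∃ i, ¬ I i ≤ J i := by simpa [Finsupp.le_def] using hIJ
        rw [DxI_xPoly_monomial, Finset.prod_eq_zero (Finset.mem_univ i)
          (Nat.descFactorial_of_lt (not_le.1 hi)), Nat.cast_zero, map_zero, map_zero, mul_zero]

theorem time_coeffs_eq_zero (F : Fin m → SmoothFn U) {T : Finset ℕ} {g : ℕ → SmoothFn U}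
    (hg : ∀ ψ, ∑ s ∈ T, g s * (DtBar F)^[s] ψ = 0) : ∀ r ∈ T, g r = 0 := by
  intro r
  induction r using Nat.strong_induction_on with
  | _ r ih =>
    intro hr
    have heval := hg (coordFn Coord.t ^ r)
    rw [Finset.sum_eq_single_of_mem r hr fun s hs hne => ?_, iterate_DtBar_t_pow, Nat.sub_self,
      pow_zero, mul_one, Nat.descFactorial_self] at heval
    · exact eq_zero_of_mul_natCast_eq_zero r.factorial_ne_zero heval
    · rcases lt_or_gt_of_ne hne with hlt | hgt
      · rw [ih s hlt hs, zero_mul]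
      · rw [iterate_DtBar_t_pow, Nat.descFactorial_of_lt hgt, Nat.cast_zero, zero_mul, mul_zero]

theorem IsNormalForm.unique {F : Fin m → SmoothFn U} {N : ℕ} {C C' : OpCoeffs U}
    (hC : IsNormalForm F N C) (hC' : IsNormalForm F N C') : C = C' := by
  obtain ⟨hf, hg, hop⟩ := hC
  obtain ⟨hf', hg', hop'⟩ := hC'
  have hdiff (i j : Fin m) (ψ : SmoothFn U) :
      ∑ I ∈ multiIndicesLE n N, (C.f i j I - C'.f i j I) * DxI I ψ +
        ∑ s ∈ Finset.Ico 1 h, (C.g i j s - C'.g i j s) * (DtBar F)^[s] ψ = 0 := by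
    have heq := hop i j ψ
    rw [hop' i j ψ,
      finsum_eq_sum_multiIndicesLE (N := N) fun I hI => by rw [hf' i j I hI, zero_mul],
      finsum_eq_sum_multiIndicesLE (N := N) fun I hI => by rw [hf i j I hI, zero_mul]] at heq
    simp only [sub_mul, Finset.sum_sub_distrib]
    rw [sub_add_sub_comm, ← heq, sub_self]
  have hspace (i j : Fin m) := space_coeffs_eq_zero F (by simp) (hdiff i j)
  have htime (i j : Fin m) := time_coeffs_eq_zero F (T := Finset.Ico 1 h)
    (g := fun s => C.g i j s - C'.g i j s) fun ψ => by
      rw [← hdiff i j ψ, Finset.sum_eq_zero (s := multiIndicesLE n N) fun I hI => by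
        rw [hspace i j I hI, zero_mul], zero_add]
  have hff : C.f = C'.f := by
    funext i j I
    by_cases hI : I ∈ multiIndicesLE n N
    · exact sub_eq_zero.1 (hspace i j I hI)
    · rw [mem_multiIndicesLE, not_le] at hI
      rw [hf i j I hI, hf' i j I hI]
  have hgg : C.g = C'.g := by
    funext i j s
    by_cases hs : s ∈ Finset.Ico 1 h
    · exact sub_eq_zero.1 (htime i j s hs)
    · rw [hg i j s hs, hg' i j s hs]
  cases C
  cases C'
  exact congrArg₂ OpCoeffs.mk hff hgg

end Uniqueness

/-! ### Order, symbol and the constant `O` -/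

section Order

variable {n m h : ℕ} {U : TopologicalSpace.Opens (Coord n m (Fin h) → ℝ)} {p : ℕ}
  {f : Fin p → SmoothFn U}

theorem finite_degree_pdu_ne_zero (f : Fin p → SmoothFn U) :
    {r : ℤ | ∃ i k s I, pdu k s I (f i) ≠ 0 ∧ r = (I.degree : ℤ)}.Finite := by
  refine (Set.finite_iUnion fun i => Set.finite_iUnion fun k =>
    (finite_pdu_ne_zero k (f i)).image fun q => (q.2.degree : ℤ)).subset ?_
  rintro r ⟨i, k, s, I, hne, rfl⟩
  exact Set.mem_iUnion.2 ⟨i, Set.mem_iUnion.2 ⟨k, (s, I), hne, rfl⟩⟩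

theorem degree_le_order {i : Fin p} {k : Fin m} {s : ℕ} {I : Fin n →₀ ℕ}
    (hne : pdu k s I (f i) ≠ 0) : (I.degree : ℤ) ≤ order f :=
  le_csSup ((Set.finite_singleton _).union (finite_degree_pdu_ne_zero f)).bddAbove
    (Or.inr ⟨i, k, s, I, hne, rfl⟩)

theorem order_le_iff {a : ℕ} : order f ≤ a ↔ ∀ i, OrdLE a (f i) := by
  refine ⟨fun hf i k s K hK => ?_, fun hf => csSup_le ⟨-1, Or.inl rfl⟩ ?_⟩
  · by_contra hne
    have := degree_le_order hne
    omega
  · rintro r (rfl | ⟨i, k, s, I, hne, rfl⟩)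
    · omega
    · by_contra hlt
      exact hne (hf i k s I (by omega))

theorem order_singleton_le_iff {a : ℕ} {f : SmoothFn U} : order ![f] ≤ a ↔ OrdLE a f := by
  rw [order_le_iff, Fin.forall_fin_one, Matrix.cons_val_fin_one]

theorem lt_of_pdu_ne_zero {k : Fin m} {s : ℕ} {I : Fin n →₀ ℕ} {f : SmoothFn U}
    (hne : pdu k s I f ≠ 0) : s < h :=
  not_le.1 fun hs => hne (pdu_of_le hs I f)

theorem tOrder_lt (hh : 0 < h) (f : Fin p → SmoothFn U) : tOrder f < h := by
  refine Nat.lt_of_le_sub_one hh (csSup_le' ?_)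
  rintro s ⟨i, k, I, hne, -⟩
  exact Nat.le_sub_one_of_lt (lt_of_pdu_ne_zero hne)

theorem le_tOrder {i : Fin p} {k : Fin m} {s : ℕ} {I : Fin n →₀ ℕ}
    (hne : pdu k s I (f i) ≠ 0) (hI : (I.degree : ℤ) = order f) : s ≤ tOrder f := by
  refine le_csSup ⟨h, ?_⟩ ⟨i, k, I, hne, hI⟩
  rintro s ⟨i, k, I, hne, -⟩
  exact (lt_of_pdu_ne_zero hne).le

theorem lexLE_tOrder {a : ℕ} (ha : order f = a) (i : Fin p) : LexLE a (tOrder f) (f i) := by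
  rintro k s K (hK | ⟨hK, hs⟩)
  · exact order_le_iff.1 ha.le i k s K hK
  · by_contra hne
    have := le_tOrder hne (by rw [hK, ha])
    omega

theorem IsGenEvolution.tOrder_eq_zero {F : Fin m → SmoothFn U} (hF : IsGenEvolution F)
    (hF0 : 0 < order F) : tOrder F = 0 := by
  refine Nat.le_zero.1 (csSup_le' ?_)
  rintro s ⟨i, k, I, hne, hI⟩
  by_contra hs
  refine hne (hF i k s I (by omega) ?_)
  rintro rfl
  rw [map_zero, Nat.cast_zero] at hI
  omega

theorem symbol_apply {a : ℕ} (ha : order f = a) (i : Fin p) (j : Fin m) :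
    symbol f i j = symbolEntry a (tOrder f) j (f i) := by
  rw [symbol, ha, Int.toNat_natCast, symbolAt_apply]

end Order

section ConstO

variable {n m h : ℕ} {U : TopologicalSpace.Opens (Coord n m (Fin h) → ℝ)}
  {F : Fin m → SmoothFn U} {N : ℕ} {C : OpCoeffs U}

theorem IsNormalForm.eq_normalFormCoeffs (hC : IsNormalForm F N C) (hFN : ∀ l, OrdLE N (F l)) :
    C = normalFormCoeffs F N :=
  hC.unique (isNormalForm_normalFormCoeffs hFN)

theorem IsNormalForm.upperBound_orders (hC : IsNormalForm F N C) (hF : IsGenEvolution F)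
    (hFN : ∀ l, OrdLE N (F l)) :
    (N : ℤ) ∈ upperBounds ({-1} ∪ {r : ℤ | ∃ i j I, r = order ![C.f i j I] - N} ∪
      {r : ℤ | ∃ i j s, r = order ![C.g i j s] - N}) := by
  have hbound {c : SmoothFn U} (hc : OrdLE (N + N) c) : order ![c] - N ≤ N := by
    have := order_singleton_le_iff.2 hc
    omega
  obtain rfl := hC.eq_normalFormCoeffs hFN
  rintro r ((rfl | ⟨i, j, I, rfl⟩) | ⟨i, j, s, rfl⟩)
  · omega
  · exact hbound (ordLE_normalFormCoeffs_f hF hFN i j I)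
  · exact hbound (ordLE_normalFormCoeffs_g hF hFN i j s)

theorem IsNormalForm.constO_le (hC : IsNormalForm F N C) (hF : IsGenEvolution F)
    (hFN : ∀ l, OrdLE N (F l)) : constO N C ≤ N :=
  csSup_le ⟨-1, Or.inl (Or.inl rfl)⟩ (hC.upperBound_orders hF hFN)

theorem IsNormalForm.neg_one_le_constO (hC : IsNormalForm F N C) (hF : IsGenEvolution F)
    (hFN : ∀ l, OrdLE N (F l)) : -1 ≤ constO N C :=
  le_csSup ⟨_, hC.upperBound_orders hF hFN⟩ (Or.inl (Or.inl rfl))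

theorem IsNormalForm.ordLE_f_of_constO_lt (hC : IsNormalForm F N C) (hF : IsGenEvolution F)
    (hFN : ∀ l, OrdLE N (F l)) {a : ℕ} (ha : constO N C < a) (i j : Fin m) (I : Fin n →₀ ℕ) :
    OrdLE (a + N - 1) (C.f i j I) := by
  have hle : order ![C.f i j I] - N ≤ constO N C :=
    le_csSup ⟨_, hC.upperBound_orders hF hFN⟩ (Or.inl (Or.inr ⟨i, j, I, rfl⟩))
  exact order_singleton_le_iff.1 (by omega)

theorem IsNormalForm.ordLE_g_of_constO_lt (hC : IsNormalForm F N C) (hF : IsGenEvolution F)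
    (hFN : ∀ l, OrdLE N (F l)) {a : ℕ} (ha : constO N C < a) (i j : Fin m) (s : ℕ) :
    OrdLE (a + N - 1) (C.g i j s) := by
  have hle : order ![C.g i j s] - N ≤ constO N C :=
    le_csSup ⟨_, hC.upperBound_orders hF hFN⟩ (Or.inr ⟨i, j, s, rfl⟩)
  exact order_singleton_le_iff.1 (by omega)

end ConstO

/-! ### Comparison of symbols -/

section SymbolComparison

variable {n m h : ℕ} {U : TopologicalSpace.Opens (Coord n m (Fin h) → ℝ)}

theorem symbolEntry_sum {α : Type*} (a b : ℕ) (j : Fin m) (S : Finset α) (f : α → SmoothFn U) :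
    symbolEntry a b j (∑ i ∈ S, f i) = ∑ i ∈ S, symbolEntry a b j (f i) := by
  simp only [symbolEntry, pdu_sum, map_sum]
  rw [Finset.sum_comm]

theorem symbolEntry_add (a b : ℕ) (j : Fin m) (f g : SmoothFn U) :
    symbolEntry a b j (f + g) = symbolEntry a b j f + symbolEntry a b j g := by
  simp only [symbolEntry, ← coe_pduDerivation, map_add, Finset.sum_add_distrib]

theorem symbolEntry_eq_zero {a b : ℕ} {j : Fin m} {f : SmoothFn U}
    (hf : ∀ K : Fin n →₀ ℕ, K.degree = a → pdu j b K f = 0) : symbolEntry a b j f = 0 :=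
  Finset.sum_eq_zero fun K hK => by rw [hf K (mem_finsuppAntidiag_univ.1 hK), map_zero]

theorem OrdLE.symbolEntry_mul {a a' : ℕ} {c : SmoothFn U} (hc : OrdLE a' c) (ha : a' < a) (b : ℕ)
    (j : Fin m) (f : SmoothFn U) :
    symbolEntry a b j (c * f) = MvPolynomial.C c * symbolEntry a b j f := by
  rw [symbolEntry, symbolEntry, Finset.mul_sum]
  refine Finset.sum_congr rfl fun K hK => ?_
  rw [mem_finsuppAntidiag_univ] at hK
  rw [pdu_mul, hc j b K (by omega), mul_zero, add_zero, MvPolynomial.C_mul_monomial]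

theorem symbolEntry_sum_mul_DxI {a N : ℕ} {c : (Fin n →₀ ℕ) → SmoothFn U}
    (hc : ∀ I, OrdLE (a + N - 1) (c I)) (hN : 0 < N) {ψ : SmoothFn U} (hψ : OrdLE a ψ) (b : ℕ)
    (j : Fin m) : symbolEntry (a + N) b j (∑ I ∈ multiIndicesLE n N, c I * DxI I ψ) =
      (∑ I ∈ Finset.finsuppAntidiag Finset.univ N, MvPolynomial.monomial I (c I)) *
        symbolEntry a b j ψ := by
  have hterm (I : Fin n →₀ ℕ) : symbolEntry (a + N) b j (c I * DxI I ψ) =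
      MvPolynomial.C (c I) * symbolEntry (a + N) b j (DxI I ψ) :=
    (hc I).symbolEntry_mul (by omega) b j _
  have htop : Finset.finsuppAntidiag Finset.univ N ⊆ multiIndicesLE n N := fun I hI =>
    mem_multiIndicesLE.2 (mem_finsuppAntidiag_univ.1 hI).le
  rw [symbolEntry_sum, ← Finset.sum_subset htop fun I hI hI' => ?_, Finset.sum_mul]
  · refine Finset.sum_congr rfl fun I hI => ?_
    rw [hterm, ← mem_finsuppAntidiag_univ.1 hI, symbolEntry_DxI hψ, ← mul_assoc,
      MvPolynomial.C_mul_monomial, mul_one]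
  · rw [mem_multiIndicesLE] at hI
    rw [mem_finsuppAntidiag_univ] at hI'
    rw [hterm, symbolEntry_eq_zero fun K hK => hψ.apply_DxI I j b K (by omega), mul_zero]

variable {F : Fin m → SmoothFn U} {N : ℕ} {C : OpCoeffs U}

theorem symbolEntry_sum_mul_iterate_DtBar (hF : IsGenEvolution F) (hN : 0 < N)
    (hFN : ∀ l, OrdLE N (F l)) {a b : ℕ} (hb : b < h) {c : ℕ → SmoothFn U}
    (hc : ∀ s, OrdLE (a + N - 1) (c s)) {ψ : SmoothFn U} (hψ : LexLE a b ψ) (j : Fin m) :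
    symbolEntry (a + N) b j (∑ s ∈ Finset.Ico 1 h, c s * (DtBar F)^[s] ψ) = 0 := by
  rw [symbolEntry_sum]
  refine Finset.sum_eq_zero fun s hs => ?_
  rw [(hc s).symbolEntry_mul (by omega), symbolEntry_eq_zero fun K hK =>
    hψ.pdu_iterate_DtBar_of_lt hb hF hN hFN (Finset.mem_Ico.1 hs).2 j hK, mul_zero]

theorem IsNormalForm.sum_monomial_f (hC : IsNormalForm F N C) (hN : 0 < N)
    (hFN : ∀ l, OrdLE N (F l)) (i l : Fin m) :
    ∑ I ∈ Finset.finsuppAntidiag Finset.univ N, MvPolynomial.monomial I (C.f i l I) =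
      (-1) ^ N * symbolEntry N 0 i (F l) := by
  obtain rfl := hC.eq_normalFormCoeffs hFN
  rw [symbolEntry, Finset.mul_sum]
  refine Finset.sum_congr rfl fun I hI => ?_
  rw [normalFormCoeffs_f_of_degree_eq F hN i l (mem_finsuppAntidiag_univ.1 hI),
    ← MvPolynomial.C_mul_monomial, map_pow, map_neg, map_one]

theorem IsNormalForm.symbolEntry_adjL (hC : IsNormalForm F N C) (hF : IsGenEvolution F)
    (hN : 0 < N) (hFN : ∀ l, OrdLE N (F l)) {a b : ℕ} (hb : b < h) (ha : constO N C < a)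
    {ψ : SmoothFn U} (hψ : LexLE a b ψ) (i l j : Fin m) :
    symbolEntry (a + N) b j (adjL F i l ψ) =
      (-1) ^ N * (symbolEntry N 0 i (F l) * symbolEntry a b j ψ) := by
  rw [hC.2.2 i l ψ, finsum_eq_sum_multiIndicesLE (N := N) fun I hI => by
      rw [hC.1 i l I hI, zero_mul], symbolEntry_add,
    symbolEntry_sum_mul_DxI (hC.ordLE_f_of_constO_lt hF hFN ha i l) hN hψ.ordLE,
    symbolEntry_sum_mul_iterate_DtBar hF hN hFN hb (hC.ordLE_g_of_constO_lt hF hFN ha i l) hψ,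
    hC.sum_monomial_f hN hFN, add_zero, mul_assoc]

theorem IsCharacteristic.sum_symbolEntry_mul {J₀ : SmoothFn U} {J : Fin n → SmoothFn U}
    {χ : Fin m → SmoothFn U} (hχ : IsCharacteristic F J₀ J χ) (hC : IsNormalForm F N C)
    (hF : IsGenEvolution F) (hN : 0 < N) (hFN : ∀ l, OrdLE N (F l)) {a b : ℕ} (hb : b < h)
    (ha : constO N C < a) (hab : ∀ l, LexLE a b (χ l)) (i j : Fin m) :
    (-1) ^ h * ∑ l, symbolEntry a b l (χ i) * symbolEntry N 0 j (F l) =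
      (-1) ^ N * ∑ l, symbolEntry N 0 i (F l) * symbolEntry a b j (χ l) := by
  have hsymbol := congrArg (symbolEntry (a + N) b j) (hχ.equation hF i)
  rw [(ordLE_neg_one_pow 0 h).symbolEntry_mul (by omega),
    (hab i).symbolEntry_iterate_DtBar hb hF hN hFN j, map_pow, map_neg, map_one, symbolEntry_sum]
    at hsymbol
  rw [hsymbol, Finset.mul_sum]
  exact Finset.sum_congr rfl fun l _ => hC.symbolEntry_adjL hF hN hFN hb ha (hab l) i l j

theorem eq_neg_one_pow_zsmul_of_neg_one_pow_mul_eq {R : Type*} [CommRing R] {x y : R} {p q : ℕ}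
    (hxy : (-1) ^ q * x = (-1) ^ p * y) : x = (-1 : ℤ) ^ (p + q) • y :=
  calc x = (-1) ^ q * ((-1) ^ q * x) := by
        rw [← mul_assoc, ← pow_add, Even.neg_one_pow ⟨q, rfl⟩, one_mul]
    _ = (-1 : ℤ) ^ (p + q) • y := by
        rw [hxy, zsmul_eq_mul]
        push_cast
        ring

end SymbolComparison

end JetCons

end

open JetCons in
theorem theorem1 {n m h N : ℕ} (hh : 0 < h)
    (U : TopologicalSpace.Opens (Coord n m (Fin h) → ℝ))
    (F : Fin m → SmoothFn U) (hF : IsGenEvolution F)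
    (hN : 0 < N) (hFN : order F = (N : ℤ)) :
    (∃! C : OpCoeffs U, IsNormalForm F N C) ∧
    ∀ C : OpCoeffs U, IsNormalForm F N C →
      constO N C ≤ N ∧
      ∀ (J₀ : SmoothFn U) (J : Fin n → SmoothFn U) (χ : Fin m → SmoothFn U),
        IsConservedCurrent F J₀ J → IsCharacteristic F J₀ J χ →
        constO N C < order χ →
        symbol χ * symbol F = (-1 : ℤ) ^ (N + h) • ((symbol F).transpose * symbol χ) := by
  have hFord : ∀ l, OrdLE N (F l) := order_le_iff.1 hFN.le
  refine ⟨⟨normalFormCoeffs F N, isNormalForm_normalFormCoeffs hFord,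
    fun C hC => hC.eq_normalFormCoeffs hFord⟩,
    fun C hC => ⟨hC.constO_le hF hFord, fun J₀ J χ _ hχ hlt => ?_⟩⟩
  have hneg := hC.neg_one_le_constO hF hFord
  obtain ⟨a, ha⟩ : ∃ a : ℕ, order χ = a := Int.eq_ofNat_of_zero_le (by omega)
  have htF : tOrder F = 0 := hF.tOrder_eq_zero (by omega)
  ext1 i j
  simp only [Matrix.smul_apply, Matrix.mul_apply, Matrix.transpose_apply, symbol_apply ha,
    symbol_apply hFN, htF]
  exact eq_neg_one_pow_zsmul_of_neg_one_pow_mul_eq (R := MvPolynomial (Fin n) (SmoothFn U)) <|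
    hχ.sum_symbolEntry_mul hC hF hN hFord (tOrder_lt hh χ) (ha ▸ hlt) (lexLE_tOrder ha) i j
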